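/- Let $X$ be a smooth ($C^\infty$) manifold (Hausdorff, second countable, without boundary) of dimension $n\ge 1$, equipped with a $C^\infty$ density $dx$ (in every smooth chart $dx=\rho(y)\,dy$ with $\rho\ge 0$ smooth), and let $f:X\to\mathbb{R}$ and $g:\mathbb{R}\times X\to\mathbb{R}$ be smooth. Assume: (i) there are a compact set $K\subset X$ and $C>0$ with $|f|\ge C$ on $X\setminus K$ (so the fiber $S=f^{-1}(0)$ is compact); (ii) the Fourier transform $\hat g(t,x)=\frac1{2\pi}\int_{\mathbb{R}}e^{-i\tau t}g(\tau,x)\,d\tau$ exists and is smooth in $t$ for almost every $x$, and $\partial_t^k\hat g\in L^1(\mathbb{R}\times X)$ for all $k\in\mathbb{N}$; (iii) near $S$, $g$ and its $x$-derivatives are rapidly decreasing in $t$: for every $p\in S$, in local coordinates around $p$, and for every multi-index $\alpha$ and every $N\in\mathbb{N}$, there is a constant $C_{\alpha,N}$ such that $|\partial_x^\alpha g(t,x)|\le C_{\alpha,N}(1+|t|)^{-N}$ for all $t\in\mathbb{R}$ and all $x$ in some neighborhood of $p$. The Leray (Liouville) measure $\sigma_S$ is the measure on $X$ carried by the regular points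 $\{x: f(x)=0,\ df(x)\ne0\}$ of the fiber which, in any local coordinates $(y_1,\dots,y_n)$ with $y_1=f$ and $dx=\rho(y)\,dy_1\cdots dy_n$, is given by $\rho(0,y_2,\dots,y_n)\,dy_2\cdots dy_n$ on $\{y_1=0\}$ (that is, $df\wedge d\sigma_S=dx$). Then $\sigma_S$ exists and is unique, and the following hold. (a) Suppose that $df\neq0$ at every point of $S$. Then the integral $I(z)=\int_X g(zf(x),x)\,dx$ converges absolutely and has a full asymptotic expansion in powers of $z^{-1}$: there are real numbers $c_0,c_1,\dots$ such that, for every $N\in\mathbb{N}$, $I(z)=\sum_{j=0}^{N-1}c_jz^{-(j+1)}+O(z^{-(N+1)})$ as $z\to+\infty$. Its leading term is given by $$I(z)=\frac1z\int_S\int_{\mathbb{R}}g(t,x)\,dt\,d\sigma_S(x)+O(z^{-2}),$$ where the integrals on the right converge absolutely. (b) Let $\Theta\in C_0^\infty(X)$ be such that $df\ne0$ at every point of $S\cap\operatorname{supp}(1-\Theta)$ (for example, $S$ has finitely many critical points and $\Theta=1$ near each of them). Then the same holds for $I_r(z)=\int_X g(zf(x),x)\,(1-\Theta(x))\,dx$: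 it converges absolutely, has a full asymptotic expansion of the same form, and $$I_r(z)=\frac1z\int_S(1-\Theta(x))\int_{\mathbb{R}}g(t,x)\,dt\,d\sigma_S(x)+O(z^{-2}).$$ -/

import Mathlib

open MeasureTheory Filter Topology Asymptotics
open scoped Manifold ContDiff

noncomputable section

namespace FiberIntegral

/-- The model space `ℝⁿ` with `n = m + 1`. -/
abbrev Model (m : ℕ) : Type := EuclideanSpace ℝ (Fin (m + 1))

/-- `x` is a regular (non-critical) point of `f` : the differential of `f` at `x` does not vanish. -/
def IsRegularPoint (m : ℕ) {X : Type*} [TopologicalSpace X] [ChartedSpace (Model m) X]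
    (f : X → ℝ) (x : X) : Prop :=
  mfderiv 𝓘(ℝ, Model m) 𝓘(ℝ, ℝ) f x ≠ 0

/-- In the coordinates `φ` the measure `μ` is `ρ(y) dy`, with `ρ` smooth and nonnegative on the
range of the coordinates. By continuity, `ρ` is determined by `μ` on `φ.target`. -/
def IsChartDensity {m : ℕ} {X : Type*} [TopologicalSpace X] [MeasurableSpace X] (μ : Measure X)
    (φ : OpenPartialHomeomorph X (Model m)) (ρ : Model m → ℝ) : Prop :=
  ContDiffOn ℝ ∞ ρ φ.target ∧ (∀ y ∈ φ.target, 0 ≤ ρ y) ∧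
    ∀ B : Set (Model m), MeasurableSet B →
      μ (φ.source ∩ φ ⁻¹' B) = ∫⁻ y in φ.target ∩ B, ENNReal.ofReal (ρ y)

/-- `μ` is a `C^∞` density on the manifold `X`: in each smooth chart it has a smooth density with
respect to Lebesgue measure. -/
def IsSmoothDensity (m : ℕ) {X : Type*} [TopologicalSpace X] [ChartedSpace (Model m) X]
    [MeasurableSpace X] (μ : Measure X) : Prop :=
  ∀ φ ∈ IsManifold.maximalAtlas 𝓘(ℝ, Model m) ∞ X, ∃ ρ : Model m → ℝ, IsChartDensity μ φ ρ

/-- The point `(0, y₂, …, yₙ)` of the hyperplane `y₁ = 0`. -/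
def slice (m : ℕ) (y : Fin m → ℝ) : Model m :=
  WithLp.toLp 2 (Fin.cons (0 : ℝ) y : Fin (m + 1) → ℝ)

/-- `σ` is the Leray (Liouville) measure of the fiber `f⁻¹(0)` relative to the density `μ = dx`.
It is carried by the regular points of the fiber. In smooth coordinates `y` with `y₁ = f`, where
`dx = ρ(y) dy₁ ∧ dy₂ ∧ … ∧ dyₙ`, the equation `df ∧ dL = dx` gives `dL = ρ(0, y') dy₂ ∧ … ∧ dyₙ`
on the fiber `y₁ = 0`, and `σ` is integration of `|dL|`. -/
def IsLerayMeasure (m : ℕ) {X : Type*} [TopologicalSpace X] [ChartedSpace (Model m) X]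
    [MeasurableSpace X] (f : X → ℝ) (μ σ : Measure X) : Prop :=
  σ {x | ¬ (f x = 0 ∧ IsRegularPoint m f x)} = 0 ∧
    ∀ φ ∈ IsManifold.maximalAtlas 𝓘(ℝ, Model m) ∞ X, (∀ x ∈ φ.source, φ x 0 = f x) →
      ∀ ρ : Model m → ℝ, IsChartDensity μ φ ρ →
        ∀ B : Set (Model m), MeasurableSet B →
          σ (φ.source ∩ φ ⁻¹' B) =
            ∫⁻ y in slice m ⁻¹' (φ.target ∩ B), ENNReal.ofReal (ρ (slice m y))

/-- The normalized Fourier transform of `g` with respect to `t`,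
`ĝ(t, x) = (2π)⁻¹ ∫ e^{-iτt} g(τ, x) dτ`. -/
def ghat {X : Type*} (g : ℝ → X → ℝ) (t : ℝ) (x : X) : ℂ :=
  (1 / (2 * (Real.pi : ℂ))) * ∫ τ : ℝ, Complex.exp (-(Complex.I * (τ : ℂ) * (t : ℂ))) * (g τ x : ℂ)

/-- The Fourier transform `ĝ` with respect to `t` exists and `∂ₜᵏ ĝ ∈ L¹(ℝ × X)` for all `k`. -/
def FourierL1 {X : Type*} [MeasurableSpace X] (μ : Measure X) (g : ℝ → X → ℝ) : Prop :=
  (∀ᵐ x ∂μ, Integrable (fun t : ℝ => g t x)) ∧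
    (∀ᵐ x ∂μ, ContDiff ℝ ∞ (fun t : ℝ => ghat g t x)) ∧
    ∀ k : ℕ, Integrable (fun p : ℝ × X => iteratedDeriv k (fun t : ℝ => ghat g t p.2) p.1)
      ((volume : Measure ℝ).prod μ)

/-- Near the point `p`, `g` and its derivatives of all orders in `x` (in local coordinates) are
rapidly decreasing in `t`, locally uniformly in `x`. -/
def RapidlyDecreasingNear (m : ℕ) {X : Type*} [TopologicalSpace X] [ChartedSpace (Model m) X]
    (g : ℝ → X → ℝ) (p : X) : Prop :=
  ∀ l N : ℕ, ∃ C : ℝ, ∀ᶠ x in 𝓝 p, ∀ t : ℝ,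
    (1 + |t|) ^ N *
      ‖iteratedFDeriv ℝ l (fun y : Model m => g t ((chartAt (Model m) p).symm y))
        (chartAt (Model m) p x)‖ ≤ C

/-- `I(z) = ∫_X g(z f(x), x) dx`. -/
def fiberIntegral {X : Type*} [MeasurableSpace X] (μ : Measure X) (f : X → ℝ) (g : ℝ → X → ℝ)
    (z : ℝ) : ℝ :=
  ∫ x, g (z * f x) x ∂μ

/-- `I_r(z) = ∫_X g(z f(x), x) (1 - Θ(x)) dx`. -/
def regularIntegral {X : Type*} [MeasurableSpace X] (μ : Measure X) (f : X → ℝ) (g : ℝ → X → ℝ)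
    (Θ : X → ℝ) (z : ℝ) : ℝ :=
  ∫ x, g (z * f x) x * (1 - Θ x) ∂μ

/-- `F(z) ∼ ∑_{j ≥ 0} c_j z^{-(j+1)}` as `z → +∞`. -/
def HasExpansion (F : ℝ → ℝ) (c : ℕ → ℝ) : Prop :=
  ∀ N : ℕ, (fun z : ℝ => F z - ∑ j ∈ Finset.range N, c j * z⁻¹ ^ (j + 1))
    =O[atTop] (fun z : ℝ => z⁻¹ ^ (N + 1))

end FiberIntegral

end

/-! Near a regular point of the fiber, f can be taken as the first coordinate s. In such coordinates
the integral becomes ∫∫ H(zs, s, y') ds dy', where H(t, s, y') is the product of g(t, ·), the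
density ρ and a cut-off. Expand H(t, ·, y') at s = 0 with t frozen, then substitute t = zs: the term
of degree j gives z^{-(j+1)} (1/j!) ∫∫ t^j ∂_s^j H(t, 0, y') dt dy', and the remainder is |s|^N
times a rapidly decreasing function of zs, whose integral is O(z^{-(N+1)}). For j = 0 the
coefficient is the integral of g dt against ρ(0, y') dy', which is the Leray measure. This is
`exists_hasExpansion_of_decay`, carried to charts by `exists_hasExpansion_model` and
`hasFiberExpansion_of_chart`.

Uniform decay in t is assumed only near S. Elsewhere, Fourier inversion gives |t|^k |g(t, x)| ≤
‖∂_t^k ĝ(·, x)‖ in L¹(ℝ), and the right side is integrable in x (`FourierL1.exists_moment_bound`).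
With k = 0 this yields absolute convergence; with k = N the region |f| > δ contributes O(z^{-N}) for
every N (`setIntegral_away_le`).

The part of S in the support of the weight is compact, so finitely many adapted charts cover it.
Bump functions split off one chart at a time, and the weight that is left lives where |f| > δ,
because |f| ≥ C outside K (`hasFiberExpansion_of_regular`).

The Leray measure does not depend on coordinates for the following reason: if h is a test function,
then s ↦ ∫ ρ h dy' over the layer y₁ = s is the continuous density of the image of hμ under f. It is
therefore determined by f, μ and h, and so is its value at s = 0
(`integral_map_sliceMeasure_congr`). The local measures then glue along a countable cover of the
regular points. -/

noncomputable section

namespace FiberIntegral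

/-! ### Taylor expansion and the asymptotics on a product ℝ × V -/

/-- Taylor's formula at `0`, with the remainder bounded through the last derivative. -/
theorem abs_sub_taylor_le {δ B : ℝ} (N : ℕ) (u : ℝ → ℝ) (hu : ContDiff ℝ ∞ u)
    (hB : ∀ s, |s| ≤ δ → |iteratedDeriv N u s| ≤ B) (s : ℝ) (hs : |s| ≤ δ) :
    |u s - ∑ j ∈ Finset.range N, s ^ j / (j.factorial : ℝ) * iteratedDeriv j u 0| ≤
      B * |s| ^ N := by
  induction N generalizing u s with
  | zero => simpa using hB s hs
  | succ N ih =>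
    have hd : ContDiff ℝ ∞ (deriv u) := by
      have := (contDiff_infty_iff_deriv (f := u)).1 hu
      exact this.2
    have hit : ∀ j, iteratedDeriv j (deriv u) = iteratedDeriv (j + 1) u := fun j => by
      rw [iteratedDeriv_succ']
    have ih' := ih (deriv u) hd (by simpa only [hit] using hB)
    set R : ℝ → ℝ := fun s =>
      u s - ∑ j ∈ Finset.range (N + 1), s ^ j / (j.factorial : ℝ) * iteratedDeriv j u 0 with hR
    have hRd : ∀ s, HasDerivAt R
        (deriv u s - ∑ j ∈ Finset.range N, s ^ j / (j.factorial : ℝ) *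
          iteratedDeriv j (deriv u) 0) s := by
      intro s
      have h1 : HasDerivAt u (deriv u s) s :=
        ((hu.differentiable (by simp)) s).hasDerivAt
      have h2 : HasDerivAt (fun s : ℝ =>
          ∑ j ∈ Finset.range (N + 1), s ^ j / (j.factorial : ℝ) * iteratedDeriv j u 0)
          (∑ j ∈ Finset.range (N + 1),
            (j * s ^ (j - 1)) / (j.factorial : ℝ) * iteratedDeriv j u 0) s := by
        apply HasDerivAt.fun_sum
        intro j _
        exact ((hasDerivAt_pow j s).div_const _).mul_const _
      have h3 : (∑ j ∈ Finset.range (N + 1),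
            (j * s ^ (j - 1)) / (j.factorial : ℝ) * iteratedDeriv j u 0) =
          ∑ j ∈ Finset.range N, s ^ j / (j.factorial : ℝ) * iteratedDeriv j (deriv u) 0 := by
        rw [Finset.sum_range_succ']
        simp only [Nat.cast_zero, zero_mul, zero_div, add_zero]
        refine Finset.sum_congr rfl fun j _ => ?_
        rw [hit, Nat.factorial_succ]
        push_cast
        have : (j : ℝ) + 1 ≠ 0 := by positivity
        have : (j.factorial : ℝ) ≠ 0 := by positivity
        field_simp
      rw [← h3]
      exact h1.sub h2
    have h0 : R 0 = 0 := by
      simp only [hR]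
      rw [Finset.sum_range_succ']
      simp
    have hB0 : 0 ≤ B := (abs_nonneg _).trans (hB s hs)
    -- The derivative of R is the Taylor remainder of u' one order lower, so the induction bounds it
    -- by B|s|^N on the segment. The mean value inequality adds the factor |s|; the 1/N! of the
    -- sharp remainder is given up.
    have key := (convex_uIcc (0 : ℝ) s).norm_image_sub_le_of_norm_hasDerivWithin_le
      (f := R) (C := B * |s| ^ N)
      (fun x _ => (hRd x).hasDerivWithinAt)
      (fun x hx => by
        have hxs : |x| ≤ |s| := by
          have := Set.abs_sub_left_of_mem_uIcc hx
          simpa using this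
        exact (ih' x (hxs.trans hs)).trans
          (by gcongr))
      (Set.left_mem_uIcc) (Set.right_mem_uIcc)
    rw [h0] at key
    simp only [sub_zero, Real.norm_eq_abs] at key
    calc |R s| ≤ B * |s| ^ N * |s| := key
      _ = B * |s| ^ (N + 1) := by ring

/-- Two powers of the weight are spent on the integrable profile (1 + t²)⁻¹ and N remain. This is
the origin of every exponent N + 2 below. -/
theorem pow_mul_le_of_one_add_pow_mul_le {N : ℕ} {t a C : ℝ} (ha : 0 ≤ a)
    (h : (1 + |t|) ^ (N + 2) * a ≤ C) : |t| ^ N * a ≤ C * (1 + t ^ 2)⁻¹ := by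
  rw [← div_eq_mul_inv, le_div_iff₀ (by positivity)]
  refine le_trans ?_ h
  have h1 : |t| ^ N ≤ (1 + |t|) ^ N := by
    gcongr
    linarith
  have h2 : 1 + t ^ 2 ≤ (1 + |t|) ^ 2 := by
    rw [← sq_abs t]
    nlinarith [abs_nonneg t]
  calc |t| ^ N * a * (1 + t ^ 2) = |t| ^ N * (1 + t ^ 2) * a := by ring
    _ ≤ (1 + |t|) ^ N * (1 + |t|) ^ 2 * a := by gcongr
    _ = _ := by ring

theorem integrable_inv_one_add_mul_sq {z : ℝ} (hz : z ≠ 0) :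
    Integrable (fun s : ℝ => (1 + (z * s) ^ 2)⁻¹) :=
  integrable_inv_one_add_sq.comp_mul_left' hz

section Euclid

variable {V : Type*} [MeasurableSpace V] {ν : Measure V}

theorem integrable_profile {L : Set V} (hL : MeasurableSet L) (hLν : ν L < ⊤) {z : ℝ}
    (hz : z ≠ 0) :
    Integrable (fun p : ℝ × V => (1 + (z * p.1) ^ 2)⁻¹ * L.indicator (fun _ => (1 : ℝ)) p.2)
      (volume.prod ν) :=
  Integrable.mul_prod (integrable_inv_one_add_mul_sq hz)
    ((integrable_indicator_iff hL).2 (integrableOn_const hLν.ne))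

theorem integral_profile [SFinite ν] {L : Set V} {z : ℝ} (hz : 0 < z) :
    ∫ p : ℝ × V, (1 + (z * p.1) ^ 2)⁻¹ * L.indicator (fun _ => (1 : ℝ)) p.2 ∂(volume.prod ν) =
      z⁻¹ * (Real.pi * ∫ y, L.indicator (fun _ => (1 : ℝ)) y ∂ν) := by
  rw [integral_prod_mul (fun s : ℝ => (1 + (z * s) ^ 2)⁻¹) (L.indicator (fun _ => (1 : ℝ))),
    Measure.integral_comp_mul_left (fun s : ℝ => (1 + s ^ 2)⁻¹) z, integral_univ_inv_one_add_sq,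
    abs_of_pos (inv_pos.2 hz), smul_eq_mul, mul_assoc]

/-- With t = zs, each power of |s| is worth a factor z⁻¹. Integrating the remaining profile in s
yields one more factor z⁻¹ (`integral_profile`). -/
theorem pow_mul_rescaled_le {N : ℕ} {z s a C : ℝ} (hz : 0 < z) (ha : 0 ≤ a)
    (h : (1 + |z * s|) ^ (N + 2) * a ≤ C) :
    |s| ^ N * a ≤ z⁻¹ ^ N * (C * (1 + (z * s) ^ 2)⁻¹) := by
  have h1 := pow_mul_le_of_one_add_pow_mul_le ha h
  rw [abs_mul, abs_of_pos hz, mul_pow] at h1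
  calc |s| ^ N * a = z⁻¹ ^ N * (z ^ N * |s| ^ N * a) := by
        have : z⁻¹ ^ N * z ^ N = 1 := by rw [← mul_pow, inv_mul_cancel₀ hz.ne', one_pow]
        linear_combination (-(|s| ^ N * a)) * this
    _ ≤ _ := by gcongr

/-- The moment integrals, after the rescaling `t = z s`. -/
theorem moment_rescaled [SFinite ν] {L : Set V} (hL : MeasurableSet L) (hLν : ν L < ⊤)
    (D : ℝ → V → ℝ)
    (hD : Measurable (fun p : ℝ × V => D p.1 p.2)) (j : ℕ) (C : ℝ)
    (hsupp : ∀ y, y ∉ L → ∀ t, D t y = 0)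
    (hdec : ∀ t y, (1 + |t|) ^ (j + 2) * |D t y| ≤ C) {z : ℝ} (hz : 0 < z) :
    Integrable (fun p : ℝ × V => p.1 ^ j * D (z * p.1) p.2) (volume.prod ν) ∧
      ∫ p : ℝ × V, p.1 ^ j * D (z * p.1) p.2 ∂(volume.prod ν) =
        (∫ y, (∫ t, t ^ j * D t y) ∂ν) * z⁻¹ ^ (j + 1) := by
  have hI : Integrable (fun p : ℝ × V => p.1 ^ j * D (z * p.1) p.2) (volume.prod ν) := by
    refine ((integrable_profile hL hLν hz.ne').const_mul (z⁻¹ ^ j * C)).mono'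
      ?_ (Eventually.of_forall fun p => ?_)
    · apply Measurable.aestronglyMeasurable
      exact (measurable_fst.pow_const j).mul
        (hD.comp ((measurable_fst.const_mul z).prodMk measurable_snd))
    · by_cases hy : p.2 ∈ L
      · rw [Set.indicator_of_mem hy, norm_mul, norm_pow, Real.norm_eq_abs, Real.norm_eq_abs]
        have := pow_mul_rescaled_le hz (abs_nonneg _) (hdec (z * p.1) p.2)
        linarith
      · rw [hsupp _ hy, Set.indicator_of_notMem hy]
        simp
  refine ⟨hI, ?_⟩
  rw [integral_prod_symm _ hI, ← integral_mul_const]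
  refine integral_congr_ae (Eventually.of_forall fun y => ?_)
  have h1 := Measure.integral_comp_mul_left (fun t : ℝ => t ^ j * D t y) z
  rw [abs_of_pos (inv_pos.2 hz), smul_eq_mul] at h1
  have h2 : (fun x : ℝ => x ^ j * D (z * x) y) =
      fun x : ℝ => z⁻¹ ^ j * ((z * x) ^ j * D (z * x) y) := by
    funext x
    have : z⁻¹ ^ j * z ^ j = 1 := by rw [← mul_pow, inv_mul_cancel₀ hz.ne', one_pow]
    rw [mul_pow]
    linear_combination (-(x ^ j * D (z * x) y)) * this
  simp only [h2]
  rw [integral_const_mul, h1]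
  ring

/-- The fast variable t and the slow variable s are separate arguments of H, so that Taylor's
formula applies in s at fixed t, before t = zs is inserted. Pointwise decay is available only for
|s| ≤ δ, with δ depending on the order; `hoff` supplies the rest in the mean. -/
theorem exists_hasExpansion_of_decay [SFinite ν] {L : Set V} (hL : MeasurableSet L) (hLν : ν L < ⊤)
    (H : ℝ → ℝ → V → ℝ)
    (hsm : ∀ t y, ContDiff ℝ ∞ (fun s => H t s y))
    (hmeas : ∀ j, Measurable (fun p : ℝ × V => iteratedDeriv j (fun s => H p.1 s p.2) 0))
    (hint : ∀ z, Integrable (fun p : ℝ × V => H (z * p.1) p.1 p.2) (volume.prod ν))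
    (hsupp : ∀ y, y ∉ L → ∀ t s, H t s y = 0)
    (hdec : ∀ l N : ℕ, ∃ δ > 0, ∃ C : ℝ, ∀ t s y, |s| ≤ δ →
      (1 + |t|) ^ N * |iteratedDeriv l (fun s => H t s y) s| ≤ C)
    (hoff : ∀ δ > 0, ∀ N : ℕ, ∃ C : ℝ, ∀ z ≥ 1,
      ∫ p in {p : ℝ × V | δ < |p.1|}, |H (z * p.1) p.1 p.2| ∂(volume.prod ν) ≤ C * z⁻¹ ^ N) :
    ∃ c : ℕ → ℝ, HasExpansion (fun z => ∫ p : ℝ × V, H (z * p.1) p.1 p.2 ∂(volume.prod ν)) c ∧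
      c 0 = ∫ y, (∫ t, H t 0 y) ∂ν ∧ Integrable (fun y => ∫ t, H t 0 y) ν := by
  set D : ℕ → ℝ → V → ℝ := fun j t y => iteratedDeriv j (fun s => H t s y) 0 with hDdef
  have hDdec : ∀ l N : ℕ, ∃ C : ℝ, ∀ t y, (1 + |t|) ^ N * |D l t y| ≤ C := by
    intro l N
    obtain ⟨δ, hδ, C, hC⟩ := hdec l N
    exact ⟨C, fun t y => hC t 0 y (by simpa using hδ.le)⟩
  have hDsupp : ∀ j, ∀ y, y ∉ L → ∀ t, D j t y = 0 := by
    intro j y hy t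
    have : (fun s => H t s y) = fun _ => 0 := funext fun s => hsupp y hy t s
    simp only [hDdef, this]
    simp
  refine ⟨fun j => (j.factorial : ℝ)⁻¹ * ∫ y, (∫ t, t ^ j * D j t y) ∂ν, fun N => ?_, by
    simp [hDdef], ?_⟩
  swap
  · obtain ⟨C, hC⟩ := hDdec 0 2
    have h1 := (moment_rescaled hL hLν (D 0) (hmeas 0) 0 C (hDsupp 0) hC one_pos).1
    simpa [hDdef] using h1.integral_prod_right
  obtain ⟨δ, hδ, CN, hCN⟩ := hdec N (N + 2)
  -- The weight is N + 2 and not j + 2: for |s| > δ the Taylor terms are bounded through |s|^j ≤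
  -- δ^{-(N-j)} |s|^N, which brings each of them to order z^{-N} times the profile. The moments
  -- themselves need only j + 2.
  choose Cj hCj using fun j => hDdec j (N + 2)
  choose C' hC' using fun j => hDdec j (j + 2)
  obtain ⟨Co, hCo⟩ := hoff δ hδ (N + 1)
  set Q : ℝ := CN + ∑ j ∈ Finset.range N, δ⁻¹ ^ (N - j) * Cj j with hQ
  -- A point of V is needed to see that the constants are nonnegative.
  rcases isEmpty_or_nonempty V with hV | ⟨⟨y₀⟩⟩
  · have : ν = 0 := Measure.eq_zero_of_isEmpty ν
    simp [this, isBigO_zero]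
  have hCN0 : 0 ≤ CN := le_trans (by positivity) (hCN 0 0 y₀ (by simpa using hδ.le))
  have hCj0 : ∀ j, 0 ≤ Cj j := fun j => le_trans (by positivity) (hCj j 0 y₀)
  have hQj : 0 ≤ ∑ j ∈ Finset.range N, δ⁻¹ ^ (N - j) * Cj j :=
    Finset.sum_nonneg fun j _ => mul_nonneg (by positivity) (hCj0 j)
  set k : ℝ → ℝ × V → ℝ := fun z p =>
    (1 + (z * p.1) ^ 2)⁻¹ * L.indicator (fun _ => (1 : ℝ)) p.2 with hk
  set R : ℝ → ℝ × V → ℝ := fun z p => H (z * p.1) p.1 p.2 -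
    ∑ j ∈ Finset.range N, p.1 ^ j / (j.factorial : ℝ) * D j (z * p.1) p.2 with hR
  have hRint : ∀ z > 0, ∫ p, R z p ∂(volume.prod ν) =
      (∫ p : ℝ × V, H (z * p.1) p.1 p.2 ∂(volume.prod ν)) - ∑ j ∈ Finset.range N,
        ((j.factorial : ℝ)⁻¹ * ∫ y, (∫ t, t ^ j * D j t y) ∂ν) * z⁻¹ ^ (j + 1) := by
    intro z hz
    have hj := fun j => moment_rescaled hL hLν (D j) (hmeas j) j (C' j) (hDsupp j) (hC' j) hz
    have hj2 : ∀ j, Integrable (fun p : ℝ × V =>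
        p.1 ^ j / (j.factorial : ℝ) * D j (z * p.1) p.2) (volume.prod ν) := fun j => by
      refine ((hj j).1.const_mul (j.factorial : ℝ)⁻¹).congr (Eventually.of_forall fun p => ?_)
      simp only
      ring
    simp only [hR]
    rw [integral_sub (hint z) (integrable_finsetSum _ fun j _ => hj2 j),
      integral_finsetSum _ fun j _ => hj2 j]
    congr 1
    refine Finset.sum_congr rfl fun j _ => ?_
    rw [mul_assoc, ← (hj j).2, ← integral_const_mul]
    refine integral_congr_ae (Eventually.of_forall fun p => ?_)
    simp only
    ring
  have hms : MeasurableSet {p : ℝ × V | δ < |p.1|} :=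
    measurableSet_lt measurable_const (continuous_abs.measurable.comp measurable_fst)
  -- For |s| ≤ δ this is Taylor's remainder bound. For |s| > δ no cancellation is used: H is kept as
  -- it is and the Taylor polynomial is estimated term by term.
  have hRle : ∀ z > 0, ∀ p : ℝ × V, |R z p| ≤
      {p : ℝ × V | δ < |p.1|}.indicator (fun p => |H (z * p.1) p.1 p.2|) p +
        z⁻¹ ^ N * Q * k z p := by
    intro z hz p
    by_cases hy : p.2 ∈ L
    · have hkp : k z p = (1 + (z * p.1) ^ 2)⁻¹ := by simp [hk, hy]
      rw [hkp]
      have hpr : (0 : ℝ) ≤ (1 + (z * p.1) ^ 2)⁻¹ := by positivity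
      by_cases hs : δ < |p.1|
      · rw [Set.indicator_of_mem (show p ∈ {p : ℝ × V | δ < |p.1|} from hs)]
        refine (abs_sub _ _).trans (add_le_add le_rfl ?_)
        have hterm : ∀ j ∈ Finset.range N,
            |p.1 ^ j / (j.factorial : ℝ) * D j (z * p.1) p.2| ≤
              z⁻¹ ^ N * (δ⁻¹ ^ (N - j) * Cj j) * (1 + (z * p.1) ^ 2)⁻¹ := by
          intro j hj
          have hjN : j ≤ N := (Finset.mem_range.1 hj).le
          have h1 := pow_mul_rescaled_le hz (abs_nonneg _) (hCj j (z * p.1) p.2)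
          have h2 : |p.1| ^ j ≤ δ⁻¹ ^ (N - j) * |p.1| ^ N := by
            have h3 : 1 ≤ δ⁻¹ ^ (N - j) * |p.1| ^ (N - j) := by
              rw [← mul_pow]
              apply one_le_pow₀
              rw [inv_mul_eq_div, one_le_div hδ]
              exact hs.le
            calc |p.1| ^ j = 1 * |p.1| ^ j := by ring
              _ ≤ δ⁻¹ ^ (N - j) * |p.1| ^ (N - j) * |p.1| ^ j := by gcongr
              _ = _ := by rw [mul_assoc, ← pow_add, Nat.sub_add_cancel hjN]
          rw [abs_mul, abs_div, abs_pow, Nat.abs_cast]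
          have h4 : |p.1| ^ j / (j.factorial : ℝ) ≤ |p.1| ^ j :=
            div_le_self (by positivity) (by exact_mod_cast Nat.factorial_pos j)
          calc |p.1| ^ j / (j.factorial : ℝ) * |D j (z * p.1) p.2|
              ≤ δ⁻¹ ^ (N - j) * |p.1| ^ N * |D j (z * p.1) p.2| := by
                gcongr
                exact h4.trans h2
            _ = δ⁻¹ ^ (N - j) * (|p.1| ^ N * |D j (z * p.1) p.2|) := by ring
            _ ≤ δ⁻¹ ^ (N - j) * (z⁻¹ ^ N * (Cj j * (1 + (z * p.1) ^ 2)⁻¹)) := by gcongr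
            _ = _ := by ring
        calc _ ≤ ∑ j ∈ Finset.range N, |p.1 ^ j / (j.factorial : ℝ) * D j (z * p.1) p.2| :=
              Finset.abs_sum_le_sum_abs _ _
          _ ≤ _ := Finset.sum_le_sum hterm
          _ = z⁻¹ ^ N * (∑ j ∈ Finset.range N, δ⁻¹ ^ (N - j) * Cj j) *
              (1 + (z * p.1) ^ 2)⁻¹ := by
              rw [Finset.mul_sum, Finset.sum_mul]
          _ ≤ _ := by
              gcongr
              linarith
      · rw [Set.indicator_of_notMem (show p ∉ {p : ℝ × V | δ < |p.1|} from hs), zero_add]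
        have hs' : |p.1| ≤ δ := not_lt.1 hs
        have hpos : (0 : ℝ) < (1 + |z * p.1|) ^ (N + 2) := by positivity
        have h1 := abs_sub_taylor_le (δ := δ) (B := CN / (1 + |z * p.1|) ^ (N + 2)) N
          (fun s => H (z * p.1) s p.2) (hsm _ _) (fun s hs => by
            rw [le_div_iff₀ hpos, mul_comm]
            exact hCN _ _ _ hs) p.1 hs'
        refine h1.trans ?_
        have h2 := pow_mul_rescaled_le (N := N) (s := p.1)
          (a := CN / (1 + |z * p.1|) ^ (N + 2)) (C := CN) hz (by positivity)
          (by rw [mul_div_cancel₀ _ hpos.ne'])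
        calc _ ≤ z⁻¹ ^ N * (CN * (1 + (z * p.1) ^ 2)⁻¹) := by rw [mul_comm]; exact h2
          _ = z⁻¹ ^ N * CN * (1 + (z * p.1) ^ 2)⁻¹ := by ring
          _ ≤ _ := by
              gcongr
              linarith
    · have h0 : R z p = 0 := by
        simp only [hR]
        rw [hsupp _ hy, Finset.sum_eq_zero]
        · simp
        · intro j _
          rw [hDsupp j _ hy, mul_zero]
      rw [h0, abs_zero]
      have hk0 : k z p = 0 := by simp [hk, hy]
      rw [hk0, mul_zero, add_zero]
      exact Set.indicator_nonneg (fun _ _ => abs_nonneg _) _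
  refine IsBigO.of_bound (Co + Q * (Real.pi * ∫ y, L.indicator (fun _ => (1 : ℝ)) y ∂ν)) ?_
  filter_upwards [eventually_ge_atTop (1 : ℝ)] with z hz
  have hz0 : 0 < z := by linarith
  have hzi : (0 : ℝ) < z⁻¹ := inv_pos.2 hz0
  rw [← hRint z hz0, Real.norm_of_nonneg (by positivity : (0 : ℝ) ≤ z⁻¹ ^ (N + 1))]
  have hi1 : Integrable ({p : ℝ × V | δ < |p.1|}.indicator
      (fun p => |H (z * p.1) p.1 p.2|)) (volume.prod ν) := (hint z).abs.indicator hms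
  have hi2 : Integrable (fun p => z⁻¹ ^ N * Q * k z p) (volume.prod ν) :=
    (integrable_profile hL hLν hz0.ne').const_mul _
  calc ‖∫ p, R z p ∂(volume.prod ν)‖
      ≤ ∫ p, ({p : ℝ × V | δ < |p.1|}.indicator (fun p => |H (z * p.1) p.1 p.2|) p +
        z⁻¹ ^ N * Q * k z p) ∂(volume.prod ν) :=
        norm_integral_le_of_norm_le (hi1.add hi2) (Eventually.of_forall fun p => hRle z hz0 p)
    _ = (∫ p in {p : ℝ × V | δ < |p.1|}, |H (z * p.1) p.1 p.2| ∂(volume.prod ν)) +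
        z⁻¹ ^ N * Q * (z⁻¹ * (Real.pi * ∫ y, L.indicator (fun _ => (1 : ℝ)) y ∂ν)) := by
        rw [integral_add hi1 hi2, integral_indicator hms, integral_const_mul,
          integral_profile hz0]
    _ ≤ Co * z⁻¹ ^ (N + 1) +
        z⁻¹ ^ N * Q * (z⁻¹ * (Real.pi * ∫ y, L.indicator (fun _ => (1 : ℝ)) y ∂ν)) := by
        gcongr
        exact hCo z hz
    _ = _ := by ring

end Euclid

/-! ### Rapidly decreasing families: changes of variables, products, lines -/

section Rapid

variable {E F : Type*} [NormedAddCommGroup E] [NormedSpace ℝ E]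
  [NormedAddCommGroup F] [NormedSpace ℝ F]

/-- All derivatives of the functions `G t` decrease rapidly in `t`, locally uniformly at `y`. -/
def RapidAt (G : ℝ → E → ℝ) (y : E) : Prop :=
  ∀ l N : ℕ, ∃ C : ℝ, ∀ᶠ y' in 𝓝 y, ∀ t : ℝ, (1 + |t|) ^ N * ‖iteratedFDeriv ℝ l (G t) y'‖ ≤ C

theorem RapidAt.congr {G G' : ℝ → E → ℝ} {y : E} (h : RapidAt G y)
    (hG : ∀ᶠ y' in 𝓝 y, ∀ t, G' t y' = G t y') : RapidAt G' y := by
  intro l N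
  obtain ⟨C, hC⟩ := h l N
  refine ⟨C, ?_⟩
  filter_upwards [hC, eventually_eventually_nhds.2 hG] with y' h1 h2 t
  have : G' t =ᶠ[𝓝 y'] G t := by
    filter_upwards [h2] with x hx using hx t
  rw [(this.iteratedFDeriv ℝ l).self_of_nhds]
  exact h1 t

theorem RapidAt.zero (y : E) : RapidAt (fun _ _ => (0 : ℝ)) y := by
  intro l N
  refine ⟨0, Eventually.of_forall fun y' t => ?_⟩
  simp

/-- A single bound for all derivatives of order at most `l`. -/
theorem RapidAt.exists_forall_le {G : ℝ → E → ℝ} {y : E} (h : RapidAt G y) (l N : ℕ) :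
    ∃ C : ℝ, 0 ≤ C ∧ ∀ᶠ y' in 𝓝 y, ∀ i ≤ l, ∀ t : ℝ,
      (1 + |t|) ^ N * ‖iteratedFDeriv ℝ i (G t) y'‖ ≤ C := by
  choose C hC using fun i => h i N
  refine ⟨∑ i ∈ Finset.range (l + 1), |C i|, Finset.sum_nonneg fun _ _ => abs_nonneg _, ?_⟩
  have : ∀ᶠ y' in 𝓝 y, ∀ i ∈ Finset.range (l + 1), ∀ t : ℝ,
      (1 + |t|) ^ N * ‖iteratedFDeriv ℝ i (G t) y'‖ ≤ C i :=
    (eventually_all_finset _).2 fun i _ => hC i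
  filter_upwards [this] with y' h1 i hi t
  have hi' : i ∈ Finset.range (l + 1) := Finset.mem_range.2 (by omega)
  exact (h1 i hi' t).trans ((le_abs_self _).trans
    (Finset.single_le_sum (f := fun i => |C i|) (fun _ _ => abs_nonneg _) hi'))

theorem exists_eventually_norm_iteratedFDeriv_le {T : E → F} {W : Set E} (hW : IsOpen W)
    (hT : ContDiffOn ℝ ∞ T W) {y : E} (hy : y ∈ W) (l : ℕ) :
    ∃ D : ℝ, 1 ≤ D ∧ ∀ᶠ y' in 𝓝 y, ∀ i ≤ l, ‖iteratedFDeriv ℝ i T y'‖ ≤ D := by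
  have hc : ∀ i : ℕ, ContinuousAt (iteratedFDeriv ℝ i T) y := by
    intro i
    have h1 := hT.continuousOn_iteratedFDerivWithin (m := i) (by exact_mod_cast le_top)
      hW.uniqueDiffOn
    exact (h1.congr fun x hx => (iteratedFDerivWithin_of_isOpen i hW hx).symm).continuousAt
      (hW.mem_nhds hy)
  refine ⟨1 + ∑ i ∈ Finset.range (l + 1), (‖iteratedFDeriv ℝ i T y‖ + 1), ?_, ?_⟩
  · have : 0 ≤ ∑ i ∈ Finset.range (l + 1), (‖iteratedFDeriv ℝ i T y‖ + 1) :=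
      Finset.sum_nonneg fun _ _ => by positivity
    linarith
  have : ∀ᶠ y' in 𝓝 y, ∀ i ∈ Finset.range (l + 1),
      ‖iteratedFDeriv ℝ i T y'‖ < ‖iteratedFDeriv ℝ i T y‖ + 1 :=
    (eventually_all_finset _).2 fun i _ =>
      (hc i).norm.eventually_lt_const (by linarith)
  filter_upwards [this] with y' h1 i hi
  have hi' : i ∈ Finset.range (l + 1) := Finset.mem_range.2 (by omega)
  have h2 := Finset.single_le_sum (f := fun i => ‖iteratedFDeriv ℝ i T y‖ + 1)
    (fun _ _ => by positivity) hi'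
  have h3 := h1 i hi'
  linarith

/-- The derivatives of G t ∘ T involve those of G t up to the same order, with factors from T that
are independent of t. Rapid decrease is thus independent of the coordinates. -/
theorem RapidAt.comp {G : ℝ → F → ℝ} {T : E → F} {O : Set F} {W : Set E} (hO : IsOpen O)
    (hW : IsOpen W) (hG : ∀ t, ContDiffOn ℝ ∞ (G t) O) (hT : ContDiffOn ℝ ∞ T W)
    (hTW : Set.MapsTo T W O) {y : E} (hy : y ∈ W) (h : RapidAt G (T y)) :
    RapidAt (fun t => G t ∘ T) y := by
  intro l N
  obtain ⟨C, hC0, hC⟩ := h.exists_forall_le l N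
  obtain ⟨D, hD1, hD⟩ := exists_eventually_norm_iteratedFDeriv_le hW hT hy l
  have hTc : ContinuousAt T y := hT.continuousOn.continuousAt (hW.mem_nhds hy)
  refine ⟨l.factorial * C * D ^ l, ?_⟩
  filter_upwards [hTc.eventually hC, hD, hW.mem_nhds hy] with y' h1 h2 h3 t
  have hpos : 0 < (1 + |t|) ^ N := by positivity
  have key := norm_iteratedFDerivWithin_comp_le (n := l) (C := C / (1 + |t|) ^ N) (D := D)
    (hG t) hT (by exact_mod_cast le_top) hO.uniqueDiffOn hW.uniqueDiffOn hTW h3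
    (fun i hi => by
      rw [iteratedFDerivWithin_of_isOpen i hO (hTW h3), le_div_iff₀ hpos, mul_comm]
      exact h1 i hi t)
    -- The estimate for composites asks for the bound D^i on the i-th derivative, which follows from
    -- the bound D because D ≥ 1 and i ≥ 1.
    (fun i hi1 hi => by
      rw [iteratedFDerivWithin_of_isOpen i hW h3]
      exact (h2 i hi).trans (le_self_pow₀ hD1 (by omega)))
  rw [iteratedFDerivWithin_of_isOpen l hW h3] at key
  calc _ ≤ (1 + |t|) ^ N * (l.factorial * (C / (1 + |t|) ^ N) * D ^ l) := by gcongr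
    _ = _ := by field_simp

theorem RapidAt.mul {G : ℝ → E → ℝ} {a : E → ℝ} {W : Set E} (hW : IsOpen W)
    (hG : ∀ t, ContDiffOn ℝ ∞ (G t) W) (ha : ContDiffOn ℝ ∞ a W) {y : E} (hy : y ∈ W)
    (h : RapidAt G y) : RapidAt (fun t y => G t y * a y) y := by
  intro l N
  obtain ⟨C, hC0, hC⟩ := h.exists_forall_le l N
  obtain ⟨D, hD1, hD⟩ := exists_eventually_norm_iteratedFDeriv_le hW ha hy l
  refine ⟨∑ i ∈ Finset.range (l + 1), (l.choose i : ℝ) * C * D, ?_⟩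
  filter_upwards [hC, hD, hW.mem_nhds hy] with y' h1 h2 h3 t
  have key := norm_iteratedFDerivWithin_mul_le (n := l) (hG t) ha hW.uniqueDiffOn h3
    (by exact_mod_cast le_top)
  rw [iteratedFDerivWithin_of_isOpen l hW h3] at key
  refine (mul_le_mul_of_nonneg_left key (by positivity)).trans ?_
  calc _ = ∑ i ∈ Finset.range (l + 1), (l.choose i : ℝ) *
        ((1 + |t|) ^ N * ‖iteratedFDeriv ℝ i (G t) y'‖) * ‖iteratedFDeriv ℝ (l - i) a y'‖ := by
        rw [Finset.mul_sum]
        refine Finset.sum_congr rfl fun i _ => ?_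
        rw [iteratedFDerivWithin_of_isOpen i hW h3, iteratedFDerivWithin_of_isOpen _ hW h3]
        ring
    _ ≤ _ := by
        refine Finset.sum_le_sum fun i hi => ?_
        have hi' : i ≤ l := by have := Finset.mem_range.1 hi; omega
        have := h1 i hi' t
        have := h2 (l - i) (by omega)
        gcongr

/-- The derivatives along a line, through the iterated Fréchet derivatives. -/
theorem iteratedDeriv_comp_add_smul {F : E → ℝ} (hF : ContDiff ℝ ∞ F) (x e : E) (l : ℕ) (s : ℝ) :
    iteratedDeriv l (fun s : ℝ => F (x + s • e)) s =
      iteratedFDeriv ℝ l F (x + s • e) (fun _ => e) := by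
  induction l generalizing s with
  | zero => simp
  | succ l ih =>
    rw [iteratedDeriv_succ, funext ih, iteratedFDeriv_succ_apply_left]
    have h1 : HasFDerivAt (iteratedFDeriv ℝ l F) (fderiv ℝ (iteratedFDeriv ℝ l F) (x + s • e))
        (x + s • e) :=
      (hF.differentiable_iteratedFDeriv (m := l) (by exact_mod_cast ENat.natCast_lt_top l)
        _).hasFDerivAt
    have h2 : HasDerivAt (fun s : ℝ => x + s • e) e s := by
      simpa using ((hasDerivAt_id s).smul_const e).const_add x
    have h3 := h1.comp_hasDerivAt s h2
    have h4 : HasDerivAt (fun s : ℝ => iteratedFDeriv ℝ l F (x + s • e) (fun _ => e))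
        ((fderiv ℝ (iteratedFDeriv ℝ l F) (x + s • e) e) (fun _ => e)) s :=
      ((ContinuousMultilinearMap.apply ℝ (fun _ : Fin l => E) ℝ
        (fun _ => e)).hasFDerivAt.comp_hasDerivAt s h3)
    rw [h4.deriv]
    rfl

theorem abs_iteratedDeriv_comp_add_smul_le {F : E → ℝ} (hF : ContDiff ℝ ∞ F) (x e : E) (l : ℕ)
    (s : ℝ) : |iteratedDeriv l (fun s : ℝ => F (x + s • e)) s| ≤
      ‖iteratedFDeriv ℝ l F (x + s • e)‖ * ‖e‖ ^ l := by
  rw [iteratedDeriv_comp_add_smul hF]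
  simpa using (iteratedFDeriv ℝ l F (x + s • e)).le_opNorm (fun _ => e)

/-- Rapid decrease along the lines in the direction `e`, uniformly on a compact set. -/
theorem exists_uniform_decay {V : Type*} [TopologicalSpace V] {L : Set V} (hL : IsCompact L)
    {G : ℝ → E → ℝ} (hG : ∀ t, ContDiff ℝ ∞ (G t)) {b : V → E} (hb : Continuous b) (e : E)
    (hR : ∀ y ∈ L, RapidAt G (b y)) (l N : ℕ) :
    ∃ δ > 0, ∃ C : ℝ, ∀ y ∈ L, ∀ t s, |s| ≤ δ →
      (1 + |t|) ^ N * |iteratedDeriv l (fun s : ℝ => G t (b y + s • e)) s| ≤ C := by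
  refine hL.induction_on (p := fun A => ∃ δ > 0, ∃ C : ℝ, ∀ y ∈ A, ∀ t s, |s| ≤ δ →
      (1 + |t|) ^ N * |iteratedDeriv l (fun s : ℝ => G t (b y + s • e)) s| ≤ C) ?_ ?_ ?_ ?_
  · exact ⟨1, one_pos, 0, by simp⟩
  · rintro A B hAB ⟨δ, hδ, C, hC⟩
    exact ⟨δ, hδ, C, fun y hy => hC y (hAB hy)⟩
  · rintro A B ⟨δ, hδ, C, hC⟩ ⟨δ', hδ', C', hC'⟩
    refine ⟨min δ δ', lt_min hδ hδ', max C C', ?_⟩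
    rintro y (hy | hy) t s hs
    · exact (hC y hy t s (hs.trans (min_le_left _ _))).trans (le_max_left _ _)
    · exact (hC' y hy t s (hs.trans (min_le_right _ _))).trans (le_max_right _ _)
  · intro y hy
    obtain ⟨C, hC⟩ := hR y hy l N
    -- Continuity of (y, s) ↦ b y + s e at (y, 0) turns the neighborhood of b y into a product
    -- neighborhood, whose second factor provides δ.
    have hc : Tendsto (fun p : V × ℝ => b p.1 + p.2 • e) (𝓝 y ×ˢ 𝓝 0) (𝓝 (b y)) := by
      rw [← nhds_prod_eq]
      have : Continuous (fun p : V × ℝ => b p.1 + p.2 • e) := by fun_prop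
      simpa using this.tendsto (y, 0)
    obtain ⟨A, hA, B, hB, hAB⟩ := mem_prod_iff.1 (hc.eventually hC)
    obtain ⟨δ, hδ, hδB⟩ := Metric.nhds_basis_closedBall.mem_iff.1 hB
    refine ⟨A, mem_nhdsWithin_of_mem_nhds hA, δ, hδ, C * ‖e‖ ^ l, fun y' hy' t s hs => ?_⟩
    have h1 := hAB (Set.mk_mem_prod hy' (hδB (show s ∈ Metric.closedBall 0 δ by simpa using hs)))
    calc _ ≤ (1 + |t|) ^ N * (‖iteratedFDeriv ℝ l (G t) (b y' + s • e)‖ * ‖e‖ ^ l) := by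
          gcongr
          exact abs_iteratedDeriv_comp_add_smul_le (hG t) _ _ _ _
      _ = ((1 + |t|) ^ N * ‖iteratedFDeriv ℝ l (G t) (b y' + s • e)‖) * ‖e‖ ^ l := by ring
      _ ≤ _ := by
          gcongr
          exact h1 t

end Rapid

/-! ### Splitting the model space as ℝ × ℝᵐ -/

section Coordinates

variable {m : ℕ}

/-- The point `(s, y₂, …, yₙ)` of the model space. -/
def pt (m : ℕ) (s : ℝ) (y : Fin m → ℝ) : Model m :=
  WithLp.toLp 2 (Fin.cons s y : Fin (m + 1) → ℝ)

@[simp] theorem pt_apply_zero (s : ℝ) (y : Fin m → ℝ) : pt m s y 0 = s := rfl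

@[simp] theorem slice_apply_zero (y : Fin m → ℝ) : slice m y 0 = 0 := rfl

theorem pt_eq_add_smul (s : ℝ) (y : Fin m → ℝ) :
    pt m s y = slice m y + s • EuclideanSpace.single 0 1 := by
  ext i
  refine Fin.cases ?_ (fun i => ?_) i <;> simp [pt, slice]

theorem continuous_slice : Continuous (slice m) := by
  unfold slice
  refine (PiLp.continuous_toLp 2 _).comp (continuous_pi fun i => ?_)
  refine Fin.cases ?_ (fun i => ?_) i
  · simpa using continuous_const
  · simpa using continuous_apply i

theorem continuous_pt : Continuous (fun p : ℝ × (Fin m → ℝ) => pt m p.1 p.2) := by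
  simp only [pt_eq_add_smul]
  have := continuous_slice (m := m)
  fun_prop

/-- The last coordinates of a point of the model space. -/
def tailCoord (m : ℕ) (y : Model m) : Fin m → ℝ := fun i => y i.succ

theorem continuous_tailCoord : Continuous (tailCoord m) := by
  unfold tailCoord
  fun_prop

@[simp] theorem tailCoord_pt (s : ℝ) (y : Fin m → ℝ) : tailCoord m (pt m s y) = y := rfl

@[simp] theorem pt_tailCoord (y : Model m) : pt m (y 0) (tailCoord m y) = y := by
  ext i
  refine Fin.cases ?_ (fun i => ?_) i <;> simp [pt, tailCoord]

/-- The first coordinate and the others. -/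
def ptEquiv (m : ℕ) : ℝ × (Fin m → ℝ) ≃ᵐ Model m where
  toFun p := pt m p.1 p.2
  invFun y := (y 0, tailCoord m y)
  left_inv p := by simp
  right_inv y := by simp
  measurable_toFun := continuous_pt.measurable
  measurable_invFun := by
    have : Continuous fun y : Model m => (y 0, tailCoord m y) := by
      have := continuous_tailCoord (m := m)
      fun_prop
    exact this.measurable

@[simp] theorem ptEquiv_apply (p : ℝ × (Fin m → ℝ)) : ptEquiv m p = pt m p.1 p.2 := rfl

theorem measurePreserving_ptEquiv :
    MeasurePreserving (ptEquiv m) ((volume : Measure ℝ).prod volume) volume := by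
  have h1 := (volume_preserving_piFinSuccAbove (fun _ : Fin (m + 1) => ℝ) 0).symm
  have h2 := (PiLp.volume_preserving_toLp (Fin (m + 1))).comp h1
  have h3 : (ptEquiv m : ℝ × (Fin m → ℝ) → Model m) =
      WithLp.toLp 2 ∘ (MeasurableEquiv.piFinSuccAbove (fun _ : Fin (m + 1) => ℝ) 0).symm := by
    funext p
    ext i
    refine Fin.cases ?_ (fun i => ?_) i <;>
      simp [pt, MeasurableEquiv.piFinSuccAbove, Fin.insertNthEquiv]
  rw [h3]
  exact h2

/-- Fubini along the first coordinate reduces this to the product case with V = ℝᵐ and L the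
projection of K. Compactness of L makes the decay at the points y₁ = 0 uniform. -/
theorem exists_hasExpansion_model (H : ℝ → Model m → ℝ)
    (hH : ContDiff ℝ ∞ (fun p : ℝ × Model m => H p.1 p.2)) {K : Set (Model m)} (hK : IsCompact K)
    (hsupp : ∀ y, y ∉ K → ∀ t, H t y = 0) (hR : ∀ y : Model m, y 0 = 0 → RapidAt H y)
    (hoff : ∀ δ > 0, ∀ N : ℕ, ∃ C : ℝ, ∀ z ≥ 1,
      ∫ y in {y : Model m | δ < |y 0|}, |H (z * y 0) y| ≤ C * z⁻¹ ^ N) :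
    ∃ c : ℕ → ℝ, HasExpansion (fun z => ∫ y : Model m, H (z * y 0) y) c ∧
      c 0 = ∫ y : Fin m → ℝ, ∫ t, H t (slice m y) ∧
      Integrable (fun y : Fin m → ℝ => ∫ t, H t (slice m y)) := by
  have hpres := measurePreserving_ptEquiv (m := m)
  have hemb := (ptEquiv m).measurableEmbedding
  have hHt : ∀ t, ContDiff ℝ ∞ (H t) := fun t =>
    hH.comp (contDiff_const.prodMk contDiff_id)
  have hLc : IsCompact (tailCoord m '' K) := hK.image continuous_tailCoord
  have hline : ∀ t (y : Fin m → ℝ), (fun s => H t (pt m s y)) =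
      fun s : ℝ => H t (slice m y + s • EuclideanSpace.single 0 1) := fun t y => by
    simp only [pt_eq_add_smul]
  have hsupp' : ∀ y, y ∉ tailCoord m '' K → ∀ t s, H t (pt m s y) = 0 := fun y hy t s =>
    hsupp _ (fun h => hy ⟨_, h, tailCoord_pt s y⟩) t
  obtain ⟨c, hc, hc0⟩ := exists_hasExpansion_of_decay (ν := (volume : Measure (Fin m → ℝ)))
    hLc.measurableSet hLc.measure_lt_top (fun t s y => H t (pt m s y))
    (fun t y => by
      rw [hline]
      exact (hHt t).comp (contDiff_const.add (contDiff_id.smul contDiff_const)))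
    (fun j => by
      -- Joint measurability in (t, y): the derivative in s is an iterated Fréchet derivative of the
      -- function of both variables in the direction (0, e₁), hence continuous.
      have h1 : ∀ p : ℝ × (Fin m → ℝ), iteratedDeriv j (fun s => H p.1 (pt m s p.2)) 0 =
          iteratedFDeriv ℝ j (fun p : ℝ × Model m => H p.1 p.2) (p.1, slice m p.2)
            (fun _ => ((0 : ℝ), EuclideanSpace.single 0 1)) := by
        intro p
        have := iteratedDeriv_comp_add_smul hH (p.1, slice m p.2)
          ((0 : ℝ), EuclideanSpace.single 0 1) j 0
        simpa [pt_eq_add_smul] using this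
      simp only [h1]
      apply Continuous.measurable
      have h2 := hH.continuous_iteratedFDeriv (m := j) (by exact_mod_cast le_top)
      have h3 : Continuous fun p : ℝ × (Fin m → ℝ) => (p.1, slice m p.2) :=
        continuous_fst.prodMk (continuous_slice.comp continuous_snd)
      exact (ContinuousMultilinearMap.apply ℝ (fun _ : Fin j => ℝ × Model m) ℝ
        (fun _ => ((0 : ℝ), EuclideanSpace.single 0 1))).continuous.comp (h2.comp h3))
    (fun z => by
      have h1 : Integrable (fun y : Model m => H (z * y 0) y) := by
        refine Continuous.integrable_of_hasCompactSupport ?_ ?_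
        · have h3 : Continuous fun y : Model m => (z * y 0, y) := by fun_prop
          exact hH.continuous.comp h3
        · exact HasCompactSupport.intro hK fun y hy => hsupp y hy _
      exact (hpres.integrable_comp_emb hemb).2 h1)
    hsupp'
    (fun l N => by
      obtain ⟨δ, hδ, C, hC⟩ := exists_uniform_decay hLc hHt continuous_slice
        (EuclideanSpace.single 0 1)
        (fun y _ => hR (slice m y) rfl) l N
      refine ⟨δ, hδ, max C 0, fun t s y hs => ?_⟩
      by_cases hy : y ∈ tailCoord m '' K
      · rw [hline]
        exact (hC y hy t s hs).trans (le_max_left _ _)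
      · rw [show (fun s => H t (pt m s y)) = fun _ => 0 from funext fun s => hsupp' y hy t s]
        simp)
    (fun δ hδ N => by
      obtain ⟨C, hC⟩ := hoff δ hδ N
      refine ⟨C, fun z hz => le_of_eq_of_le ?_ (hC z hz)⟩
      exact hpres.setIntegral_preimage_emb hemb (fun y : Model m => |H (z * y 0) y|)
        {y : Model m | δ < |y 0|})
  refine ⟨c, ?_, hc0⟩
  convert hc using 2 with z
  exact (hpres.integral_comp hemb (fun y : Model m => H (z * y 0) y)).symm

end Coordinates

/-! ### Decay in t from the Fourier transform -/

open FourierTransform in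
/-- Fourier inversion and integration by parts: a function is controlled by the derivatives of its
Fourier transform. -/
theorem abs_pow_mul_abs_le_of_fourier (u : ℝ → ℝ) (hu : Continuous u) (hui : Integrable u)
    (h : ℝ → ℂ) (hdef : ∀ t, h t = (1 / (2 * (Real.pi : ℂ))) *
      ∫ τ : ℝ, Complex.exp (-(Complex.I * (τ : ℂ) * (t : ℂ))) * (u τ : ℂ))
    (hsm : ContDiff ℝ ∞ h) (hint : ∀ k, Integrable (iteratedDeriv k h)) (k : ℕ) (t : ℝ) :
    |t| ^ k * |u t| ≤ ∫ s, ‖iteratedDeriv k h s‖ := by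
  set U : ℝ → ℂ := fun τ => (u τ : ℂ) with hU
  have hpi : (Real.pi : ℂ) ≠ 0 := by exact_mod_cast Real.pi_ne_zero
  have h2pi : (2 * Real.pi : ℝ) ≠ 0 := by positivity
  have hFU : 𝓕 U = fun s : ℝ => (2 * (Real.pi : ℂ)) * h (2 * Real.pi * s) := by
    funext s
    rw [Real.fourier_real_eq_integral_exp_smul, hdef, ← mul_assoc,
      mul_one_div_cancel (by simp), one_mul]
    refine integral_congr_ae (Eventually.of_forall fun τ => ?_)
    simp only [smul_eq_mul, hU]
    congr 2
    push_cast
    ring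
  have h0 : Integrable h := by simpa using hint 0
  have hFUi : Integrable (𝓕 U) := by
    rw [hFU]
    exact (h0.comp_mul_left' h2pi).const_mul _
  have hinv := (Complex.continuous_ofReal.comp hu).fourierInv_fourier_eq hui.ofReal hFUi
  -- In the convention e^{-2πivξ}, the inversion formula u(t) = ∫ e^{itv} h(v) dv is the Fourier
  -- transform of h at ξ = -t/2π.
  have hut : (u t : ℂ) = 𝓕 h (-t / (2 * Real.pi)) := by
    rw [Real.fourier_real_eq_integral_exp_smul]
    have h1 : (u t : ℂ) = 𝓕⁻ (𝓕 U) t := (congrFun hinv t).symm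
    rw [h1, Real.fourierInv_eq', hFU]
    have h2 := Measure.integral_comp_mul_left
      (fun v : ℝ => Complex.exp ((-2 * Real.pi * v * (-t / (2 * Real.pi)) : ℝ) * Complex.I) • h v)
      (2 * Real.pi)
    rw [abs_of_pos (by positivity), eq_comm, inv_smul_eq_iff₀ h2pi] at h2
    rw [h2, ← integral_smul]
    refine integral_congr_ae (Eventually.of_forall fun v => ?_)
    simp only [smul_eq_mul, RCLike.inner_apply, conj_trivial, Complex.real_smul]
    have : (-2 * Real.pi * (2 * Real.pi * v) * (-t / (2 * Real.pi)) : ℝ) =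
        2 * Real.pi * (t * v) := by
      field_simp
    rw [this]
    push_cast
    ring
  -- At ξ = -t/2π, k derivatives of h multiply its transform by (2πiξ)^k = (-it)^k, of modulus
  -- |t|^k.
  have hk := congrFun (Real.fourier_iteratedDeriv (N := ⊤) (n := k) hsm (fun n _ => hint n)
    (by simp)) (-t / (2 * Real.pi))
  have hnorm : ‖𝓕 (iteratedDeriv k h) (-t / (2 * Real.pi))‖ = |t| ^ k * |u t| := by
    rw [hk, ← hut, norm_smul, norm_pow, Complex.norm_real, Real.norm_eq_abs]
    congr 2
    have : (2 * (Real.pi : ℂ) * Complex.I * ((-t / (2 * Real.pi) : ℝ) : ℂ)) =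
        -(t : ℂ) * Complex.I := by
      push_cast
      field_simp
    rw [this]
    simp
  rw [← hnorm, Real.fourier_real_eq]
  refine (norm_integral_le_integral_norm _).trans (le_of_eq ?_)
  refine integral_congr_ae (Eventually.of_forall fun v => ?_)
  simp

/-- The decrease of `g` in `t`, with integrable constants. -/
theorem FourierL1.exists_moment_bound {X : Type*} [MeasurableSpace X] {μ : Measure X} [SFinite μ]
    {g : ℝ → X → ℝ} (hgF : FourierL1 μ g) (hg : ∀ x, Continuous fun t => g t x) :
    ∃ M : ℕ → X → ℝ, (∀ k, Integrable (M k) μ) ∧ (∀ k x, 0 ≤ M k x) ∧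
      ∀ᵐ x ∂μ, ∀ k t, |t| ^ k * |g t x| ≤ M k x := by
  obtain ⟨h1, h2, h3⟩ := hgF
  refine ⟨fun k x => ∫ t, ‖iteratedDeriv k (fun t : ℝ => ghat g t x) t‖,
    fun k => (h3 k).integral_norm_prod_right, fun k x => integral_nonneg fun _ => norm_nonneg _, ?_⟩
  have h4 := ae_all_iff.2 fun k => (h3 k).prod_left_ae
  filter_upwards [h1, h2, h4] with x hx1 hx2 hx4 k t
  exact abs_pow_mul_abs_le_of_fourier (fun t => g t x) (hg x) hx1 (fun t => ghat g t x)
    (fun t => rfl) hx2 hx4 k t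

/-! ### Adapted charts: f as the first coordinate -/

/-- A nonzero linear form is the first coordinate of a linear automorphism. -/
theorem exists_equiv_apply_zero_eq {m : ℕ} (l : Model m →L[ℝ] ℝ) (hl : l ≠ 0) :
    ∃ A : Model m ≃L[ℝ] Model m, ∀ v, A v 0 = l v := by
  obtain ⟨i, hi⟩ : ∃ i, l (EuclideanSpace.single i 1) ≠ 0 := by
    by_contra! h
    refine hl (ContinuousLinearMap.coe_injective
      ((EuclideanSpace.basisFun (Fin (m + 1)) ℝ).toBasis.ext fun i => ?_))
    simpa using h i
  -- The swap moves the i-th coordinate into slot 0, where l v replaces it. If all other coordinates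
  -- vanish then l v = v_i l(e_i), and l(e_i) ≠ 0 gives injectivity.
  set σ := Equiv.swap (0 : Fin (m + 1)) i
  let A₀ : Model m →ₗ[ℝ] Model m :=
    { toFun := fun v => WithLp.toLp 2 (fun j => if j = 0 then l v else v (σ j))
      map_add' := fun v w => by
        ext j
        by_cases hj : j = 0 <;> simp [hj]
      map_smul' := fun c v => by
        ext j
        by_cases hj : j = 0 <;> simp [hj] }
  have hA : ∀ v j, A₀ v j = if j = 0 then l v else v (σ j) := fun v j => rfl
  have hinj : Function.Injective A₀ := by
    rw [injective_iff_map_eq_zero]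
    intro v hv
    have h1 : ∀ k, k ≠ i → v k = 0 := by
      intro k hk
      have h2 : σ k ≠ 0 := by
        intro h
        have : k = σ 0 := by rw [← h, Equiv.swap_apply_self]
        exact hk (this.trans (Equiv.swap_apply_left _ _))
      have h3 := hA v (σ k)
      rw [hv, if_neg h2, Equiv.swap_apply_self] at h3
      simpa using h3.symm
    have h4 : v = v i • EuclideanSpace.single i (1 : ℝ) := by
      ext k
      by_cases hk : k = i
      · subst hk
        simp
      · simp [h1 k hk, hk]
    have h5 := hA v 0
    rw [hv, if_pos rfl, h4, map_smul, smul_eq_mul] at h5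
    have h6 : v i = 0 := by
      have := mul_eq_zero.1 (h5.symm.trans (by simp))
      exact this.resolve_right hi
    rw [h4, h6, zero_smul]
  refine ⟨(LinearEquiv.ofInjectiveEndo A₀ hinj).toContinuousLinearEquiv, fun v => ?_⟩
  exact hA v 0

/-- A function with nonzero differential is the first of a system of local coordinates. -/
theorem exists_openPartialHomeomorph_apply_zero_eq {m : ℕ} {F : Model m → ℝ} {O : Set (Model m)}
    (hO : IsOpen O) (hF : ContDiffOn ℝ ∞ F O) {a : Model m} (ha : a ∈ O) (hd : fderiv ℝ F a ≠ 0) :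
    ∃ Φ : OpenPartialHomeomorph (Model m) (Model m), a ∈ Φ.source ∧ Φ.source ⊆ O ∧
      ContDiffOn ℝ ∞ Φ Φ.source ∧ ContDiffOn ℝ ∞ Φ.symm Φ.target ∧ ∀ y, Φ y 0 = F y := by
  obtain ⟨A, hA⟩ := exists_equiv_apply_zero_eq _ hd
  -- Since (A y)₀ = dF_a(y), the correction makes the first coordinate exactly F; it has zero
  -- derivative at a, so dG_a = A is invertible.
  set G : Model m → Model m := fun y =>
    A y + (F y - fderiv ℝ F a y) • EuclideanSpace.single 0 (1 : ℝ) with hG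
  have hGO : ContDiffOn ℝ ∞ G O := by
    refine A.contDiff.contDiffOn.add ((hF.sub ?_).smul contDiffOn_const)
    exact (fderiv ℝ F a).contDiff.contDiffOn
  have hGat : ∀ y ∈ O, ContDiffAt ℝ ∞ G y := fun y hy => hGO.contDiffAt (hO.mem_nhds hy)
  have hGa : HasFDerivAt G (A : Model m →L[ℝ] Model m) a := by
    have h1 : HasFDerivAt F (fderiv ℝ F a) a :=
      ((hF.contDiffAt (hO.mem_nhds ha)).differentiableAt (by simp)).hasFDerivAt
    have h2 := (A.hasFDerivAt (x := a)).add
      ((h1.sub (fderiv ℝ F a).hasFDerivAt).smul_const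
        (EuclideanSpace.single (0 : Fin (m + 1)) (1 : ℝ)))
    exact h2.congr_fderiv (by simp)
  set Φ₀ := (hGat a ha).toOpenPartialHomeomorph G hGa (by simp) with hΦ₀
  have hcont : ContinuousOn (fderiv ℝ G) O :=
    hGO.continuousOn_fderiv_of_isOpen hO (by simp)
  -- The inverse function theorem gives smoothness of the inverse at G(a) only. Restricting to the
  -- open set where dG is invertible gives it on the whole target.
  set W := O ∩ fderiv ℝ G ⁻¹' Set.range ((↑) : (Model m ≃L[ℝ] Model m) → _) with hW
  have hWo : IsOpen W := hcont.isOpen_inter_preimage hO ContinuousLinearEquiv.isOpen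
  have hcoe : ∀ y, Φ₀ y = G y := fun y => rfl
  refine ⟨Φ₀.restrOpen W hWo, ⟨?_, ha, A, hGa.fderiv.symm⟩, fun y hy => hy.2.1, ?_, ?_, fun y => ?_⟩
  · exact (hGat a ha).mem_toOpenPartialHomeomorph_source hGa (by simp)
  · exact hGO.mono fun y hy => hy.2.1
  · intro y hy
    have hs := (Φ₀.restrOpen W hWo).map_target hy
    obtain ⟨hO', B, hB⟩ := hs.2
    refine ContDiffAt.contDiffWithinAt ?_
    refine (Φ₀.restrOpen W hWo).contDiffAt_symm (f₀' := B) hy ?_ (hGat _ hO')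
    rw [hB]
    exact ((hGat _ hO').differentiableAt (by simp)).hasFDerivAt
  · change G y 0 = F y
    simp [hG, hA]

variable {m : ℕ} {X : Type*} [TopologicalSpace X] [ChartedSpace (Model m) X]

/-- `φ` is a smooth chart whose first coordinate is `f`. -/
def IsAdaptedChart (f : X → ℝ) (φ : OpenPartialHomeomorph X (Model m)) : Prop :=
  φ ∈ IsManifold.maximalAtlas 𝓘(ℝ, Model m) ∞ X ∧ ∀ x ∈ φ.source, φ x 0 = f x

variable [IsManifold 𝓘(ℝ, Model m) ∞ X]

theorem IsRegularPoint.exists_isAdaptedChart {f : X → ℝ}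
    (hf : ContMDiff 𝓘(ℝ, Model m) 𝓘(ℝ, ℝ) ∞ f) {p : X} (hp : IsRegularPoint m f p) :
    ∃ φ : OpenPartialHomeomorph X (Model m), p ∈ φ.source ∧ IsAdaptedChart f φ := by
  set c := chartAt (Model m) p with hc
  have hcm : c ∈ IsManifold.maximalAtlas 𝓘(ℝ, Model m) ∞ X :=
    IsManifold.chart_mem_maximalAtlas p
  have hcp : p ∈ c.source := mem_chart_source _ p
  have hF : ContDiffOn ℝ ∞ (f ∘ c.symm) c.target := by
    rw [← contMDiffOn_iff_contDiffOn]
    exact hf.comp_contMDiffOn (contMDiffOn_symm_of_mem_maximalAtlas hcm)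
  have hd : fderiv ℝ (f ∘ c.symm) (c p) ≠ 0 := by
    intro h
    apply hp
    have h1 : MDifferentiableAt 𝓘(ℝ, Model m) 𝓘(ℝ, ℝ) f p := hf.mdifferentiable (by simp) p
    refine h1.mfderiv.trans ?_
    change fderivWithin ℝ (f ∘ c.symm) (Set.range id) (c p) = 0
    rw [Set.range_id, fderivWithin_univ]
    exact h
  obtain ⟨Φ, haΦ, hΦO, hΦ1, hΦ2, hΦ0⟩ := exists_openPartialHomeomorph_apply_zero_eq c.open_target hF
    (c.map_source hcp) hd
  refine ⟨c.trans Φ, ⟨hcp, haΦ⟩, ?_, ?_⟩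
  · apply OpenPartialHomeomorph.mem_maximalAtlas_of_contMDiffOn
    · exact (contMDiffOn_iff_contDiffOn.2 hΦ1).comp
        ((contMDiffOn_of_mem_maximalAtlas hcm).mono fun x hx => hx.1) fun x hx => hx.2
    · exact (contMDiffOn_symm_of_mem_maximalAtlas hcm).comp
        ((contMDiffOn_iff_contDiffOn.2 hΦ2).mono fun x hx => hx.1) fun x hx => hx.2
  · intro x hx
    change Φ (c x) 0 = f x
    rw [hΦ0, Function.comp_apply, c.left_inv hx.1]

omit [IsManifold 𝓘(ℝ, Model m) ∞ X] in
-- In the chart f is a coordinate function, whose differential is nonzero. The adapted charts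
-- therefore cover exactly the regular points.
theorem IsAdaptedChart.isRegularPoint {f : X → ℝ} (hf : ContMDiff 𝓘(ℝ, Model m) 𝓘(ℝ, ℝ) ∞ f)
    {φ : OpenPartialHomeomorph X (Model m)} (hφ : IsAdaptedChart f φ) {x : X}
    (hx : x ∈ φ.source) : IsRegularPoint m f x := by
  intro h
  have hy : φ x ∈ φ.target := φ.map_source hx
  have h1 : MDifferentiableAt 𝓘(ℝ, Model m) 𝓘(ℝ, ℝ) f (φ.symm (φ x)) :=
    hf.mdifferentiable (by simp) _
  have h2 : MDifferentiableAt 𝓘(ℝ, Model m) 𝓘(ℝ, Model m) φ.symm (φ x) :=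
    (contMDiffAt_symm_of_mem_maximalAtlas hφ.1 hy).mdifferentiableAt (by simp)
  have h3 := mfderiv_comp (φ x) h1 h2
  have hz : mfderiv 𝓘(ℝ, Model m) 𝓘(ℝ, ℝ) f (φ.symm (φ x)) = 0 := by
    rw [φ.left_inv hx]
    exact h
  rw [hz, mfderiv_eq_fderiv] at h3
  have h4 : (f ∘ φ.symm) =ᶠ[𝓝 (φ x)] fun y =>
      (EuclideanSpace.proj (0 : Fin (m + 1)) : _ →L[ℝ] ℝ) y := by
    filter_upwards [φ.open_target.mem_nhds hy] with y hy
    have := hφ.2 _ (φ.map_target hy)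
    rw [φ.right_inv hy] at this
    exact this.symm
  rw [h4.fderiv_eq, ContinuousLinearMap.fderiv] at h3
  have h5 := DFunLike.congr_fun h3 (EuclideanSpace.single (0 : Fin (m + 1)) (1 : ℝ))
  have h6 : (EuclideanSpace.single (0 : Fin (m + 1)) (1 : ℝ) : Model m) 0 = 0 := h5
  simp at h6

/-! ### Measures read in charts and the slice measure -/

theorem measurableSet_source_inter_preimage {X Y : Type*} [TopologicalSpace X] [MeasurableSpace X]
    [OpensMeasurableSpace X] [TopologicalSpace Y] [MeasurableSpace Y] [BorelSpace Y]
    (e : OpenPartialHomeomorph X Y) {B : Set Y} (hB : MeasurableSet B) :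
    MeasurableSet (e.source ∩ e ⁻¹' B) := by
  have h1 : Measurable (e.source.domRestrict e) := e.continuousOn.domRestrict.measurable
  have h2 := e.open_source.measurableSet.subtype_image (h1 hB)
  convert h2 using 1
  ext x
  simp [Set.domRestrict, and_comm]

section Charts

variable {X Y : Type*} [TopologicalSpace X] [MeasurableSpace X] [BorelSpace X]
  [TopologicalSpace Y] [MeasurableSpace Y] [BorelSpace Y]

theorem aemeasurable_symm (e : OpenPartialHomeomorph X Y) {τ : Measure Y}
    (hτ : τ e.targetᶜ = 0) : AEMeasurable e.symm τ := by
  have h1 : τ.restrict e.target = τ := Measure.restrict_eq_self_of_ae_mem (by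
    rw [ae_iff]
    exact hτ)
  rw [← h1]
  exact e.symm.continuousOn.aemeasurable e.open_target.measurableSet

/-- A measure on the source of a chart is determined by its coordinate expression. -/
theorem restrict_source_eq_map_symm_iff (e : OpenPartialHomeomorph X Y) {ν : Measure X}
    {τ : Measure Y} (hτ : τ e.targetᶜ = 0) :
    ν.restrict e.source = τ.map e.symm ↔
      ∀ B, MeasurableSet B → ν (e.source ∩ e ⁻¹' B) = τ B := by
  have hae := aemeasurable_symm e hτ
  have hinter : ∀ B : Set Y, τ (e.target ∩ B) = τ B := fun B => by
    rw [Set.inter_comm]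
    exact measure_inter_conull hτ
  constructor
  · intro h B hB
    have h1 := measurableSet_source_inter_preimage e hB
    have h2 : ν (e.source ∩ e ⁻¹' B) = ν.restrict e.source (e.source ∩ e ⁻¹' B) := by
      rw [Measure.restrict_apply h1]
      congr 1
      ext x
      simp only [Set.mem_inter_iff]
      tauto
    rw [h2, h, Measure.map_apply_of_aemeasurable hae h1, ← hinter, ← hinter B]
    congr 1
    ext y
    simp only [Set.mem_inter_iff, Set.mem_preimage]
    constructor
    · rintro ⟨hy, -, hyB⟩
      exact ⟨hy, by rwa [e.right_inv hy] at hyB⟩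
    · rintro ⟨hy, hyB⟩
      exact ⟨hy, e.map_target hy, by rwa [e.right_inv hy]⟩
  · intro h
    ext A hA
    have h1 : MeasurableSet (e.target ∩ e.symm ⁻¹' A) :=
      measurableSet_source_inter_preimage e.symm hA
    rw [Measure.restrict_apply hA, Measure.map_apply_of_aemeasurable hae hA, ← hinter, ← h _ h1]
    congr 1
    ext x
    simp only [Set.mem_inter_iff, Set.mem_preimage]
    constructor
    · rintro ⟨hxA, hx⟩
      exact ⟨hx, e.map_source hx, by simpa [e.left_inv hx] using hxA⟩
    · rintro ⟨hx, -, hxA⟩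
      exact ⟨by simpa [e.left_inv hx] using hxA, hx⟩

end Charts

section Leray

variable {m : ℕ} {X : Type*} [TopologicalSpace X] [MeasurableSpace X] [BorelSpace X]

/-- The measure `ρ(y) dy` on the range of the coordinates. -/
def chartMeasure (φ : OpenPartialHomeomorph X (Model m)) (ρ : Model m → ℝ) : Measure (Model m) :=
  (volume.restrict φ.target).withDensity fun y => ENNReal.ofReal (ρ y)

/-- The measure `ρ(0, y') dy'` on the hyperplane `y₁ = 0`. -/
def sliceMeasure (φ : OpenPartialHomeomorph X (Model m)) (ρ : Model m → ℝ) : Measure (Model m) :=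
  ((volume.restrict (slice m ⁻¹' φ.target)).withDensity
    fun y => ENNReal.ofReal (ρ (slice m y))).map (slice m)

variable {φ : OpenPartialHomeomorph X (Model m)} {ρ : Model m → ℝ}

omit [MeasurableSpace X] [BorelSpace X] in
theorem chartMeasure_apply {B : Set (Model m)} (hB : MeasurableSet B) :
    chartMeasure φ ρ B = ∫⁻ y in φ.target ∩ B, ENNReal.ofReal (ρ y) := by
  rw [chartMeasure, withDensity_apply _ hB, Measure.restrict_restrict hB, Set.inter_comm]

omit [MeasurableSpace X] [BorelSpace X] in
theorem sliceMeasure_apply {B : Set (Model m)} (hB : MeasurableSet B) :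
    sliceMeasure φ ρ B = ∫⁻ y in slice m ⁻¹' (φ.target ∩ B), ENNReal.ofReal (ρ (slice m y)) := by
  have hs := continuous_slice.measurable (α := Fin m → ℝ) (γ := Model m) hB
  rw [sliceMeasure, Measure.map_apply continuous_slice.measurable hB, withDensity_apply _ hs,
    Measure.restrict_restrict hs, Set.inter_comm, Set.preimage_inter]

omit [MeasurableSpace X] [BorelSpace X] in
theorem chartMeasure_compl_target : chartMeasure φ ρ φ.targetᶜ = 0 := by
  simp [chartMeasure_apply φ.open_target.measurableSet.compl]

omit [MeasurableSpace X] [BorelSpace X] in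
theorem sliceMeasure_compl_target : sliceMeasure φ ρ φ.targetᶜ = 0 := by
  simp [sliceMeasure_apply φ.open_target.measurableSet.compl]

theorem IsChartDensity.restrict_eq {μ : Measure X} (h : IsChartDensity μ φ ρ) :
    μ.restrict φ.source = (chartMeasure φ ρ).map φ.symm :=
  (restrict_source_eq_map_symm_iff φ chartMeasure_compl_target).2 fun B hB => by
    rw [h.2.2 B hB, chartMeasure_apply hB]

/-- The condition on sets becomes an equality of measures on each chart domain, the form needed for
gluing and for integration. -/
theorem isLerayMeasure_iff [ChartedSpace (Model m) X] {f : X → ℝ} {μ σ : Measure X} :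
    IsLerayMeasure m f μ σ ↔ σ {x | ¬ (f x = 0 ∧ IsRegularPoint m f x)} = 0 ∧
      ∀ φ : OpenPartialHomeomorph X (Model m), IsAdaptedChart f φ → ∀ ρ, IsChartDensity μ φ ρ →
        σ.restrict φ.source = (sliceMeasure φ ρ).map φ.symm := by
  refine and_congr Iff.rfl ⟨fun h φ hφ ρ hρ => ?_, fun h φ h1 h2 ρ hρ B hB => ?_⟩
  · refine (restrict_source_eq_map_symm_iff φ sliceMeasure_compl_target).2 fun B hB => ?_
    rw [h φ hφ.1 hφ.2 ρ hρ B hB, sliceMeasure_apply hB]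
  · rw [(restrict_source_eq_map_symm_iff φ sliceMeasure_compl_target).1 (h φ ⟨h1, h2⟩ ρ hρ) B hB,
      sliceMeasure_apply hB]

omit [MeasurableSpace X] [BorelSpace X] in
theorem aemeasurable_density (hρ : ContDiffOn ℝ ∞ ρ φ.target) :
    AEMeasurable (fun y => ENNReal.ofReal (ρ y)) (volume.restrict φ.target) :=
  (hρ.continuousOn.aemeasurable φ.open_target.measurableSet).ennreal_ofReal

omit [MeasurableSpace X] [BorelSpace X] in
theorem isOpen_slice_preimage : IsOpen (slice m ⁻¹' φ.target) :=
  φ.open_target.preimage continuous_slice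

omit [MeasurableSpace X] [BorelSpace X] in
theorem aemeasurable_slice_density (hρ : ContDiffOn ℝ ∞ ρ φ.target) :
    AEMeasurable (fun y => ENNReal.ofReal (ρ (slice m y)))
      (volume.restrict (slice m ⁻¹' φ.target)) := by
  have h1 : ContinuousOn (fun y => ρ (slice m y)) (slice m ⁻¹' φ.target) :=
    hρ.continuousOn.comp continuous_slice.continuousOn fun y hy => hy
  exact (h1.aemeasurable isOpen_slice_preimage.measurableSet).ennreal_ofReal

theorem setIntegral_source_eq {μ : Measure X} (h : IsChartDensity μ φ ρ) {u : X → ℝ}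
    (hu : StronglyMeasurable u) :
    ∫ x in φ.source, u x ∂μ = ∫ y, φ.target.indicator (fun y => ρ y * u (φ.symm y)) y := by
  rw [h.restrict_eq, integral_map (aemeasurable_symm φ chartMeasure_compl_target)
    hu.aestronglyMeasurable, chartMeasure,
    integral_withDensity_eq_integral_toReal_smul₀ (aemeasurable_density h.1)
      (Eventually.of_forall fun _ => ENNReal.ofReal_lt_top),
    integral_indicator φ.open_target.measurableSet]
  refine setIntegral_congr_fun φ.open_target.measurableSet fun y hy => ?_
  simp only [smul_eq_mul]
  rw [ENNReal.toReal_ofReal (h.2.1 y hy)]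

theorem integral_map_sliceMeasure {μ : Measure X} (h : IsChartDensity μ φ ρ) {u : X → ℝ}
    (hu : StronglyMeasurable u) :
    ∫ x, u x ∂((sliceMeasure φ ρ).map φ.symm) =
      ∫ y, φ.target.indicator (fun y => ρ y * u (φ.symm y)) (slice m y) := by
  have h1 := aemeasurable_symm φ (sliceMeasure_compl_target (φ := φ) (ρ := ρ))
  have hms : MeasurableSet (slice m ⁻¹' φ.target) := isOpen_slice_preimage.measurableSet
  have h3 : (fun y => φ.target.indicator (fun y => ρ y * u (φ.symm y)) (slice m y)) =
      (slice m ⁻¹' φ.target).indicator fun y => ρ (slice m y) * u (φ.symm (slice m y)) := by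
    funext y
    by_cases hy : slice m y ∈ φ.target
    · rw [Set.indicator_of_mem hy, Set.indicator_of_mem (show y ∈ slice m ⁻¹' φ.target from hy)]
    · rw [Set.indicator_of_notMem hy,
        Set.indicator_of_notMem (show y ∉ slice m ⁻¹' φ.target from hy)]
  rw [integral_map h1 hu.aestronglyMeasurable, h3, integral_indicator hms]
  have h2 : AEStronglyMeasurable (fun y => u (φ.symm y)) (sliceMeasure φ ρ) :=
    (hu.measurable.comp_aemeasurable h1).aestronglyMeasurable
  rw [sliceMeasure] at h2 ⊢
  rw [integral_map continuous_slice.aemeasurable h2,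
    integral_withDensity_eq_integral_toReal_smul₀ (aemeasurable_slice_density h.1)
      (Eventually.of_forall fun _ => ENNReal.ofReal_lt_top)]
  refine setIntegral_congr_fun hms fun y hy => ?_
  simp only [smul_eq_mul]
  rw [ENNReal.toReal_ofReal (h.2.1 _ hy)]

theorem integrable_map_sliceMeasure {μ : Measure X} (h : IsChartDensity μ φ ρ) {u : X → ℝ}
    (hu : StronglyMeasurable u) (hi : Integrable (fun y =>
      φ.target.indicator (fun y => ρ y * u (φ.symm y)) (slice m y))) :
    Integrable u ((sliceMeasure φ ρ).map φ.symm) := by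
  have h1 := aemeasurable_symm φ (sliceMeasure_compl_target (φ := φ) (ρ := ρ))
  have hms : MeasurableSet (slice m ⁻¹' φ.target) := isOpen_slice_preimage.measurableSet
  rw [integrable_map_measure hu.aestronglyMeasurable h1]
  have h2 : AEStronglyMeasurable (u ∘ φ.symm) (sliceMeasure φ ρ) :=
    (hu.measurable.comp_aemeasurable h1).aestronglyMeasurable
  rw [sliceMeasure] at h2 ⊢
  rw [integrable_map_measure h2 continuous_slice.aemeasurable,
    integrable_withDensity_iff_integrable_smul₀' (aemeasurable_slice_density h.1)
      (Eventually.of_forall fun _ => ENNReal.ofReal_lt_top)]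
  refine (hi.integrableOn (s := slice m ⁻¹' φ.target)).congr_fun (fun y hy => ?_) hms
  simp only [smul_eq_mul, Function.comp_apply]
  rw [ENNReal.toReal_ofReal (h.2.1 _ hy),
    Set.indicator_of_mem (show slice m y ∈ φ.target from hy)]

end Leray

/-- The extension by zero of a function supported in a closed subset of its domain. -/
theorem contDiff_indicator {E : Type*} [NormedAddCommGroup E] [NormedSpace ℝ E] {n : ℕ∞ω}
    {O K : Set E} (hO : IsOpen O) (hK : IsClosed K) (hKO : K ⊆ O) {v : E → ℝ}
    (hv : ContDiffOn ℝ n v O) (h0 : ∀ y ∈ O, y ∉ K → v y = 0) :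
    ContDiff ℝ n (O.indicator v) := by
  rw [contDiff_iff_contDiffAt]
  intro y
  by_cases hy : y ∈ K
  · refine (hv.contDiffAt (hO.mem_nhds (hKO hy))).congr_of_eventuallyEq ?_
    filter_upwards [hO.mem_nhds (hKO hy)] with x hx using Set.indicator_of_mem hx v
  · refine (contDiffAt_const (c := (0 : ℝ))).congr_of_eventuallyEq ?_
    filter_upwards [hK.isOpen_compl.mem_nhds hy] with x hx
    by_cases hxO : x ∈ O
    · rw [Set.indicator_of_mem hxO, h0 x hxO hx]
    · rw [Set.indicator_of_notMem hxO]

/-! ### Layer integrals and independence of the coordinates -/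

section Layers

variable {m : ℕ} {X : Type*} [TopologicalSpace X]

/-- The function `ρ u`, read in the coordinates `φ` and extended by zero. -/
def coordExt (φ : OpenPartialHomeomorph X (Model m)) (ρ : Model m → ℝ) (u : X → ℝ) :
    Model m → ℝ :=
  φ.target.indicator fun y => ρ y * u (φ.symm y)

variable {φ : OpenPartialHomeomorph X (Model m)} {ρ : Model m → ℝ} {h : X → ℝ}

theorem isCompact_image_tsupport (hc : HasCompactSupport h) (hs : tsupport h ⊆ φ.source) :
    IsCompact (φ '' tsupport h) :=
  hc.isCompact.image_of_continuousOn (φ.continuousOn.mono hs)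

theorem image_tsupport_subset (hs : tsupport h ⊆ φ.source) : φ '' tsupport h ⊆ φ.target := by
  rintro _ ⟨x, hx, rfl⟩
  exact φ.map_source (hs hx)

theorem apply_symm_eq_zero {y : Model m} (hy : y ∈ φ.target) (hy' : y ∉ φ '' tsupport h) :
    h (φ.symm y) = 0 := by
  by_contra hne
  exact hy' ⟨φ.symm y, subset_tsupport h hne, φ.right_inv hy⟩

theorem coordExt_eq_zero {y : Model m} (hy : y ∉ φ '' tsupport h) : coordExt φ ρ h y = 0 := by
  by_cases hyt : y ∈ φ.target
  · rw [coordExt, Set.indicator_of_mem hyt, apply_symm_eq_zero hyt hy, mul_zero]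
  · rw [coordExt, Set.indicator_of_notMem hyt]

theorem continuous_coordExt (hρ : ContDiffOn ℝ ∞ ρ φ.target) (hh : Continuous h)
    (hc : HasCompactSupport h) (hs : tsupport h ⊆ φ.source) : Continuous (coordExt φ ρ h) := by
  rw [← contDiff_zero (𝕜 := ℝ)]
  refine contDiff_indicator φ.open_target (isCompact_image_tsupport hc hs).isClosed
    (image_tsupport_subset hs) ?_ fun y hy hy' => by rw [apply_symm_eq_zero hy hy', mul_zero]
  rw [contDiffOn_zero]
  exact hρ.continuousOn.mul (hh.comp_continuousOn φ.symm.continuousOn)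

/-- The integral of `h` over the layer `y₁ = s`. -/
def layerIntegral (φ : OpenPartialHomeomorph X (Model m)) (ρ : Model m → ℝ) (h : X → ℝ) (s : ℝ) :
    ℝ :=
  ∫ y, coordExt φ ρ h (pt m s y)

theorem integrable_coordExt (hρ : ContDiffOn ℝ ∞ ρ φ.target) (hh : Continuous h)
    (hc : HasCompactSupport h) (hs : tsupport h ⊆ φ.source) : Integrable (coordExt φ ρ h) :=
  (continuous_coordExt hρ hh hc hs).integrable_of_hasCompactSupport
    (HasCompactSupport.intro (isCompact_image_tsupport hc hs) fun _ hy => coordExt_eq_zero hy)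

theorem integrable_coordExt_pt (hρ : ContDiffOn ℝ ∞ ρ φ.target) (hh : Continuous h)
    (hc : HasCompactSupport h) (hs : tsupport h ⊆ φ.source) :
    Integrable (fun p : ℝ × (Fin m → ℝ) => coordExt φ ρ h (pt m p.1 p.2))
      ((volume : Measure ℝ).prod volume) :=
  (measurePreserving_ptEquiv.integrable_comp_emb (ptEquiv m).measurableEmbedding).2
    (integrable_coordExt hρ hh hc hs)

theorem integrable_layerIntegral (hρ : ContDiffOn ℝ ∞ ρ φ.target) (hh : Continuous h)
    (hc : HasCompactSupport h) (hs : tsupport h ⊆ φ.source) : Integrable (layerIntegral φ ρ h) :=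
  (integrable_coordExt_pt hρ hh hc hs).integral_prod_left

/-- The layer integrals are determined by f and hμ only for almost every s; continuity gives a
meaning to the value at s = 0. -/
theorem continuous_layerIntegral (hρ : ContDiffOn ℝ ∞ ρ φ.target) (hh : Continuous h)
    (hc : HasCompactSupport h) (hs : tsupport h ⊆ φ.source) :
    Continuous (layerIntegral φ ρ h) := by
  have hL : IsCompact (tailCoord m '' (φ '' tsupport h)) :=
    (isCompact_image_tsupport hc hs).image continuous_tailCoord
  have h1 : layerIntegral φ ρ h = fun s =>
      ∫ y in tailCoord m '' (φ '' tsupport h), coordExt φ ρ h (pt m s y) := by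
    funext s
    refine (setIntegral_eq_integral_of_forall_compl_eq_zero fun y hy => ?_).symm
    exact coordExt_eq_zero fun h' => hy ⟨_, h', tailCoord_pt s y⟩
  rw [h1]
  exact continuous_parametric_integral_of_continuous (f := fun s y => coordExt φ ρ h (pt m s y))
    ((continuous_coordExt hρ hh hc hs).comp continuous_pt) hL

variable [MeasurableSpace X] [BorelSpace X] [ChartedSpace (Model m) X]

/-- The layer integrals are the density of the image of `h μ` under `f`. -/
theorem setIntegral_layerIntegral {μ : Measure X} {f : X → ℝ} (hf : Continuous f)
    (hφ : IsAdaptedChart f φ) (hρ : IsChartDensity μ φ ρ) (hh : Continuous h)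
    (hc : HasCompactSupport h) (hs : tsupport h ⊆ φ.source) {B : Set ℝ} (hB : MeasurableSet B) :
    ∫ s in B, layerIntegral φ ρ h s = ∫ x in f ⁻¹' B, h x ∂μ := by
  have hfB : MeasurableSet (f ⁻¹' B) := hf.measurable hB
  have hm : StronglyMeasurable ((f ⁻¹' B).indicator h) :=
    hh.stronglyMeasurable.indicator hfB
  have h1 : ∫ x in φ.source, (f ⁻¹' B).indicator h x ∂μ = ∫ x in f ⁻¹' B, h x ∂μ := by
    rw [← integral_indicator hfB]
    refine setIntegral_eq_integral_of_forall_compl_eq_zero fun x hx => ?_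
    have : h x = 0 := image_eq_zero_of_notMem_tsupport fun h' => hx (hs h')
    simp [Set.indicator, this]
  have h2 : ∀ p : ℝ × (Fin m → ℝ), φ.target.indicator
      (fun y => ρ y * (f ⁻¹' B).indicator h (φ.symm y)) (pt m p.1 p.2) =
      (B ×ˢ Set.univ).indicator (fun p => coordExt φ ρ h (pt m p.1 p.2)) p := by
    intro p
    by_cases hp : pt m p.1 p.2 ∈ φ.target
    · have h3 : f (φ.symm (pt m p.1 p.2)) = p.1 := by
        rw [← hφ.2 _ (φ.map_target hp), φ.right_inv hp, pt_apply_zero]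
      rw [Set.indicator_of_mem hp]
      by_cases hpB : p.1 ∈ B
      · rw [Set.indicator_of_mem (show φ.symm (pt m p.1 p.2) ∈ f ⁻¹' B by
          rwa [Set.mem_preimage, h3]), Set.indicator_of_mem (by simpa using hpB), coordExt,
          Set.indicator_of_mem hp]
      · rw [Set.indicator_of_notMem (show φ.symm (pt m p.1 p.2) ∉ f ⁻¹' B by
          rwa [Set.mem_preimage, h3]), Set.indicator_of_notMem (by simpa using hpB), mul_zero]
    · rw [Set.indicator_of_notMem hp]
      refine (Set.indicator_apply_eq_zero.2 fun _ => ?_).symm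
      rw [coordExt, Set.indicator_of_notMem hp]
  rw [← h1, setIntegral_source_eq hρ hm,
    ← measurePreserving_ptEquiv.integral_comp (ptEquiv m).measurableEmbedding]
  simp only [ptEquiv_apply, h2]
  rw [integral_indicator (hB.prod MeasurableSet.univ), ← Measure.prod_restrict,
    Measure.restrict_univ, integral_prod]
  · rfl
  · have := (integrable_coordExt_pt hρ.1 hh hc hs).integrableOn (s := B ×ˢ Set.univ)
    rwa [IntegrableOn, ← Measure.prod_restrict, Measure.restrict_univ] at this

/-- The integral over the fiber does not depend on the coordinates. -/
theorem integral_map_sliceMeasure_congr {μ : Measure X} {f : X → ℝ} (hf : Continuous f)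
    {ψ : OpenPartialHomeomorph X (Model m)} {ρ' : Model m → ℝ}
    (hφ : IsAdaptedChart f φ) (hρ : IsChartDensity μ φ ρ)
    (hψ : IsAdaptedChart f ψ) (hρ' : IsChartDensity μ ψ ρ') (hh : Continuous h)
    (hc : HasCompactSupport h) (hs : tsupport h ⊆ φ.source) (hs' : tsupport h ⊆ ψ.source) :
    ∫ x, h x ∂((sliceMeasure φ ρ).map φ.symm) = ∫ x, h x ∂((sliceMeasure ψ ρ').map ψ.symm) := by
  rw [integral_map_sliceMeasure hρ hh.stronglyMeasurable,
    integral_map_sliceMeasure hρ' hh.stronglyMeasurable]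
  -- Both sides are densities of the same image measure, so they agree almost everywhere, then
  -- everywhere by continuity, and in particular at s = 0.
  have h1 : layerIntegral φ ρ h =ᵐ[volume] layerIntegral ψ ρ' h := by
    refine (integrable_layerIntegral hρ.1 hh hc hs).ae_eq_of_forall_setIntegral_eq _ _
      (integrable_layerIntegral hρ'.1 hh hc hs') fun B hB _ => ?_
    rw [setIntegral_layerIntegral hf hφ hρ hh hc hs hB,
      setIntegral_layerIntegral hf hψ hρ' hh hc hs' hB]
  have h2 := (continuous_layerIntegral hρ.1 hh hc hs).ae_eq_iff_eq volume
    (continuous_layerIntegral hρ'.1 hh hc hs') |>.1 h1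
  exact congrFun h2 0

end Layers

/-! ### Gluing measures along open covers -/

section Gluing

variable {X : Type*} [TopologicalSpace X] [SecondCountableTopology X] [MeasurableSpace X]
  [BorelSpace X]

omit [BorelSpace X] in
/-- Measures that agree on the members of an open cover agree on its union. -/
theorem restrict_iUnion_congr_of_isOpen {ι : Type*} {U : ι → Set X} (hU : ∀ i, IsOpen (U i))
    {ν ν' : Measure X} (h : ∀ i, ν.restrict (U i) = ν'.restrict (U i)) :
    ν.restrict (⋃ i, U i) = ν'.restrict (⋃ i, U i) := by
  obtain ⟨T, hT, hTU⟩ := TopologicalSpace.isOpen_iUnion_countable U hU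
  rw [← hTU, Measure.restrict_biUnion_congr hT]
  exact fun i _ => h i

/-- A compatible family of measures on open sets is the family of restrictions of a measure. -/
theorem exists_measure_of_compatible {ι : Type*} {U : ι → Set X} (hU : ∀ i, IsOpen (U i))
    (ν : ι → Measure X)
    (h : ∀ i j, (ν i).restrict (U i ∩ U j) = (ν j).restrict (U i ∩ U j)) :
    ∃ σ : Measure X, σ (⋃ i, U i)ᶜ = 0 ∧ ∀ i, σ.restrict (U i) = (ν i).restrict (U i) := by
  rcases isEmpty_or_nonempty ι with hι | ⟨⟨i₀⟩⟩
  · exact ⟨0, by simp, fun i => (hι.false i).elim⟩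
  obtain ⟨e, he⟩ : ∃ e : ℕ → ι, ⋃ n, U (e n) = ⋃ i, U i := by
    obtain ⟨T, hT, hTU⟩ := TopologicalSpace.isOpen_iUnion_countable U hU
    rcases T.eq_empty_or_nonempty with rfl | hne
    · refine ⟨fun _ => i₀, ?_⟩
      rw [← hTU]
      have : U i₀ ⊆ ∅ := (Set.subset_iUnion U i₀).trans (by simp [← hTU])
      simpa using this
    · obtain ⟨e, rfl⟩ := hT.exists_eq_range hne
      exact ⟨e, by simpa using hTU⟩
  -- The measure sought is the sum of the ν (e n) restricted to disjoint pieces D n ⊆ U (e n);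
  -- compatibility makes the choice of pieces immaterial.
  set D := disjointed fun n => U (e n) with hD
  have hDm : ∀ n, MeasurableSet (D n) := fun n =>
    MeasurableSet.disjointed (fun n => (hU (e n)).measurableSet) n
  have hDd : Pairwise (Function.onFun Disjoint D) := disjoint_disjointed _
  have hDU : ∀ n, D n ⊆ U (e n) := fun n => disjointed_subset _ n
  have hDi : ⋃ n, D n = ⋃ i, U i := by rw [← he, hD, iUnion_disjointed]
  have hres : ∀ (i) (n), ((ν (e n)).restrict (D n)).restrict (U i) =
      (ν i).restrict (D n ∩ U i) := by
    intro i n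
    rw [Measure.restrict_restrict (hU i).measurableSet, Set.inter_comm]
    exact Measure.restrict_congr_mono (Set.inter_subset_inter_left _ (hDU n)) (by
      rw [h (e n) i])
  refine ⟨Measure.sum fun n => (ν (e n)).restrict (D n), ?_, fun i => ?_⟩
  · rw [← hDi, Measure.sum_apply _ (MeasurableSet.iUnion hDm).compl]
    refine ENNReal.tsum_eq_zero.2 fun n => ?_
    rw [Measure.restrict_apply (MeasurableSet.iUnion hDm).compl]
    have : (⋃ n, D n)ᶜ ∩ D n = ∅ := by
      ext x
      simp only [Set.mem_inter_iff, Set.mem_compl_iff, Set.mem_iUnion, Set.mem_empty_iff_false]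
      tauto
    rw [this, measure_empty]
  · rw [Measure.restrict_sum _ (hU i).measurableSet]
    simp only [hres]
    rw [← Measure.restrict_iUnion]
    · rw [← Set.iUnion_inter, hDi, Set.inter_eq_right.2 (Set.subset_iUnion U i)]
    · exact fun a b hab => (hDd hab).mono Set.inter_subset_left Set.inter_subset_left
    · exact fun n => (hDm n).inter (hU i).measurableSet

/-- Two measures that give the same integrals to the continuous functions with compact support
in an open set agree on this open set. -/
theorem restrict_eq_of_forall_integral_eq [T2Space X] [LocallyCompactSpace X] {W : Set X}
    (hW : IsOpen W) {ν ν' : Measure X}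
    (hi : ∀ h : X → ℝ, Continuous h → HasCompactSupport h → tsupport h ⊆ W →
      Integrable h ν ∧ Integrable h ν' ∧ ∫ x, h x ∂ν = ∫ x, h x ∂ν') :
    ν.restrict W = ν'.restrict W := by
  have hloc : ∀ x : W, ∃ N : Set X, IsOpen N ∧ (x : X) ∈ N ∧ ν.restrict N = ν'.restrict N := by
    rintro ⟨x, hx⟩
    obtain ⟨K, hK, hxK, hKW⟩ := exists_compact_subset hW hx
    obtain ⟨L, hL, hKL, hLW⟩ := exists_compact_between hK hW hKW
    -- Multiplication by the cut-off k gives finite measures, which are determined by bounded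
    -- continuous functions. Since k = 1 on K, nothing is lost on the interior of K.
    obtain ⟨k, hk1, hk0, hkc, hk⟩ := exists_continuous_one_zero_of_isCompact hK
      isOpen_interior.isClosed_compl (Set.disjoint_compl_right_iff_subset.2 hKL)
    have hkL : tsupport k ⊆ L := by
      refine closure_minimal (fun y hy => ?_) hL.isClosed
      by_contra hyL
      exact hy (hk0 fun hy' => hyL (interior_subset hy'))
    have hkW : tsupport k ⊆ W := hkL.trans hLW
    have hkm : Measurable fun x => ENNReal.ofReal (k x) := k.continuous.measurable.ennreal_ofReal
    have hfin : ∀ τ : Measure X, Integrable k τ →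
        IsFiniteMeasure (τ.withDensity fun x => ENNReal.ofReal (k x)) := fun τ hτ =>
      isFiniteMeasure_withDensity_ofReal hτ.2
    obtain ⟨h1, h2, -⟩ := hi k k.continuous hkc hkW
    have := hfin ν h1
    have := hfin ν' h2
    have key : ν.withDensity (fun x => ENNReal.ofReal (k x)) =
        ν'.withDensity fun x => ENNReal.ofReal (k x) := by
      refine ext_of_forall_integral_eq_of_IsFiniteMeasure fun b => ?_
      rw [integral_withDensity_eq_integral_toReal_smul hkm
          (Eventually.of_forall fun _ => ENNReal.ofReal_lt_top),
        integral_withDensity_eq_integral_toReal_smul hkm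
          (Eventually.of_forall fun _ => ENNReal.ofReal_lt_top)]
      have hkb : ∀ x, (ENNReal.ofReal (k x)).toReal • b x = k x * b x := fun x => by
        rw [ENNReal.toReal_ofReal (hk x).1, smul_eq_mul]
      simp only [hkb]
      refine (hi (fun x => k x * b x) (k.continuous.mul b.continuous) hkc.mul_right ?_).2.2
      exact (tsupport_mul_subset_left (f := k) (g := b)).trans hkW
    refine ⟨interior K, isOpen_interior, hxK, ?_⟩
    have hone : ∀ τ : Measure X, (τ.withDensity fun x => ENNReal.ofReal (k x)).restrict
        (interior K) = τ.restrict (interior K) := by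
      intro τ
      ext A hA
      rw [Measure.restrict_apply hA, Measure.restrict_apply hA,
        withDensity_apply _ (hA.inter isOpen_interior.measurableSet),
        setLIntegral_congr_fun (g := fun _ => 1) (hA.inter isOpen_interior.measurableSet)]
      · simp
      · intro y hy
        simp only [hk1 (interior_subset hy.2), Pi.one_apply, ENNReal.ofReal_one]
    rw [← hone ν, key, hone]
  choose N hNo hxN hN using hloc
  refine Measure.restrict_congr_mono (t := ⋃ x, N x) (fun x hx => ?_)
    (restrict_iUnion_congr_of_isOpen hNo hN)
  exact Set.mem_iUnion.2 ⟨⟨x, hx⟩, hxN _⟩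

end Gluing

/-! ### Existence and uniqueness of the Leray measure -/

section Leray

variable {m : ℕ} {X : Type*} [TopologicalSpace X] [T2Space X] [SecondCountableTopology X]
  [MeasurableSpace X] [BorelSpace X] [ChartedSpace (Model m) X]

omit [T2Space X] [SecondCountableTopology X] [ChartedSpace (Model m) X] in
theorem integrable_map_sliceMeasure_of_continuous {μ : Measure X}
    {φ : OpenPartialHomeomorph X (Model m)} {ρ : Model m → ℝ} (hρ : IsChartDensity μ φ ρ)
    {h : X → ℝ} (hh : Continuous h)
    (hc : HasCompactSupport h) (hs : tsupport h ⊆ φ.source) :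
    Integrable h ((sliceMeasure φ ρ).map φ.symm) := by
  refine integrable_map_sliceMeasure hρ hh.stronglyMeasurable ?_
  refine Continuous.integrable_of_hasCompactSupport
    ((continuous_coordExt hρ.1 hh hc hs).comp continuous_slice) ?_
  refine HasCompactSupport.intro
    ((isCompact_image_tsupport hc hs).image continuous_tailCoord) fun y hy => ?_
  exact coordExt_eq_zero fun h' => hy ⟨_, h', tailCoord_pt 0 y⟩

theorem map_sliceMeasure_restrict_congr {μ : Measure X} {f : X → ℝ} (hf : Continuous f)
    {φ ψ : OpenPartialHomeomorph X (Model m)} {ρ ρ' : Model m → ℝ}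
    (hφ : IsAdaptedChart f φ) (hρ : IsChartDensity μ φ ρ)
    (hψ : IsAdaptedChart f ψ) (hρ' : IsChartDensity μ ψ ρ') :
    ((sliceMeasure φ ρ).map φ.symm).restrict (φ.source ∩ ψ.source) =
      ((sliceMeasure ψ ρ').map ψ.symm).restrict (φ.source ∩ ψ.source) := by
  have := ChartedSpace.locallyCompactSpace (Model m) X
  refine restrict_eq_of_forall_integral_eq (φ.open_source.inter ψ.open_source)
    fun h hh hc hs => ⟨?_, ?_, ?_⟩
  · exact integrable_map_sliceMeasure_of_continuous hρ hh hc (hs.trans Set.inter_subset_left)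
  · exact integrable_map_sliceMeasure_of_continuous hρ' hh hc (hs.trans Set.inter_subset_right)
  · exact integral_map_sliceMeasure_congr hf hφ hρ hψ hρ' hh hc
      (hs.trans Set.inter_subset_left) (hs.trans Set.inter_subset_right)

variable [IsManifold 𝓘(ℝ, Model m) ∞ X]

/-- The Leray measure exists and is unique. -/
theorem existsUnique_isLerayMeasure {μ : Measure X} (hμ : IsSmoothDensity m μ) {f : X → ℝ}
    (hf : ContMDiff 𝓘(ℝ, Model m) 𝓘(ℝ, ℝ) ∞ f) : ∃! σ : Measure X, IsLerayMeasure m f μ σ := by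
  -- The index set contains every adapted chart with every density, so the glued measure satisfies
  -- the definition in all of them at once.
  let I := {q : OpenPartialHomeomorph X (Model m) × (Model m → ℝ) //
    IsAdaptedChart f q.1 ∧ IsChartDensity μ q.1 q.2}
  let U : I → Set X := fun i => i.1.1.source
  have hU : ∀ i, IsOpen (U i) := fun i => i.1.1.open_source
  let ν : I → Measure X := fun i => (sliceMeasure i.1.1 i.1.2).map i.1.1.symm
  have hmemU : ∀ {x}, IsRegularPoint m f x → x ∈ ⋃ i, U i := by
    intro x hx
    obtain ⟨φ, hxφ, hφ⟩ := hx.exists_isAdaptedChart hf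
    obtain ⟨ρ, hρ⟩ := hμ φ hφ.1
    exact Set.mem_iUnion.2 ⟨⟨(φ, ρ), hφ, hρ⟩, hxφ⟩
  have hregU : ∀ {x}, x ∈ ⋃ i, U i → IsRegularPoint m f x := by
    intro x hx
    obtain ⟨i, hi⟩ := Set.mem_iUnion.1 hx
    exact i.2.1.isRegularPoint hf hi
  have hνU : ∀ i, (ν i).restrict (U i) = ν i := by
    intro i
    refine Measure.restrict_eq_self_of_ae_mem ?_
    rw [ae_iff]
    have hae := aemeasurable_symm i.1.1 (sliceMeasure_compl_target (φ := i.1.1) (ρ := i.1.2))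
    change ν i (U i)ᶜ = 0
    rw [Measure.map_apply_of_aemeasurable hae (hU i).measurableSet.compl]
    refine measure_mono_null (fun y hy => ?_) (sliceMeasure_compl_target (φ := i.1.1) (ρ := i.1.2))
    exact fun hy' => hy (i.1.1.map_target hy')
  have hνf : ∀ i, ν i (f ⁻¹' {0})ᶜ = 0 := by
    intro i
    have hae := aemeasurable_symm i.1.1 (sliceMeasure_compl_target (φ := i.1.1) (ρ := i.1.2))
    have hfm : MeasurableSet (f ⁻¹' {0})ᶜ :=
      (hf.continuous.measurable (measurableSet_singleton 0)).compl
    have h0 : MeasurableSet {y : Model m | y 0 ≠ 0} := by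
      have : Continuous fun y : Model m => y 0 := by fun_prop
      exact (isOpen_ne_fun this continuous_const).measurableSet
    rw [Measure.map_apply_of_aemeasurable hae hfm]
    refine measure_mono_null (t := i.1.1.targetᶜ ∪ {y : Model m | y 0 ≠ 0}) (fun y hy => ?_)
      (measure_union_null sliceMeasure_compl_target ?_)
    · by_cases hyt : y ∈ i.1.1.target
      · right
        intro hy0
        apply hy
        change f (i.1.1.symm y) = 0
        rw [← i.2.1.2 _ (i.1.1.map_target hyt), i.1.1.right_inv hyt, hy0]
      · exact Or.inl hyt
    · rw [sliceMeasure_apply h0]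
      have : slice m ⁻¹' (i.1.1.target ∩ {y : Model m | y 0 ≠ 0}) = ∅ := by
        ext y
        simp
      rw [this]
      simp
  obtain ⟨σ, hσ0, hσ⟩ := exists_measure_of_compatible hU ν fun i j =>
    map_sliceMeasure_restrict_congr hf.continuous i.2.1 i.2.2 j.2.1 j.2.2
  refine ⟨σ, isLerayMeasure_iff.2 ⟨?_, fun φ hφ ρ hρ => ?_⟩, fun σ' hσ' => ?_⟩
  -- The index set is uncountable, so a countable subcover is needed before null sets can be added
  -- up.
  · have h1 : σ.restrict (⋃ i, U i) (f ⁻¹' {0})ᶜ = 0 := by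
      obtain ⟨T, hT, hTU⟩ := TopologicalSpace.isOpen_iUnion_countable U hU
      rw [← hTU, ← nonpos_iff_eq_zero]
      have := hT.to_subtype
      rw [Set.biUnion_eq_iUnion]
      refine (Measure.restrict_iUnion_le _).trans ?_
      rw [Measure.sum_apply_of_countable]
      refine (ENNReal.tsum_eq_zero.2 fun i => ?_).le
      rw [hσ, hνU]
      exact hνf i
    have h2 : σ (f ⁻¹' {0})ᶜ = 0 := by
      rwa [Measure.restrict_eq_self_of_ae_mem (by rw [ae_iff]; exact hσ0)] at h1
    refine measure_mono_null (fun x hx => ?_) (measure_union_null hσ0 h2)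
    by_contra hx'
    simp only [Set.mem_union, Set.mem_compl_iff, not_or, not_not] at hx'
    exact hx ⟨hx'.2, hregU hx'.1⟩
  · rw [hσ ⟨(φ, ρ), hφ, hρ⟩]
    exact hνU ⟨(φ, ρ), hφ, hρ⟩
  · have h1 := isLerayMeasure_iff.1 hσ'
    have h2 : σ'.restrict (⋃ i, U i) = σ.restrict (⋃ i, U i) :=
      restrict_iUnion_congr_of_isOpen hU fun i => by
        rw [hσ i, hνU i]
        exact h1.2 _ i.2.1 _ i.2.2
    rwa [Measure.restrict_eq_self_of_ae_mem, Measure.restrict_eq_self_of_ae_mem] at h2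
    · rw [ae_iff]
      exact hσ0
    · rw [ae_iff]
      have h3 : {a | a ∉ ⋃ i, U i} ⊆ {x | ¬ (f x = 0 ∧ IsRegularPoint m f x)} :=
        fun x hx h4 => hx (hmemU h4.2)
      exact measure_mono_null h3 h1.1

end Leray

/-! ### Expansions with a weight: additivity -/

section Expansion

variable {X : Type*} [MeasurableSpace X]

/-- The weighted integral `∫ g(z f(x), x) w(x) dμ` has a full asymptotic expansion, whose leading
coefficient is the integral over the fiber of `w(x) ∫ g(t, x) dt`. -/
def HasFiberExpansion (μ σ : Measure X) (f : X → ℝ) (g : ℝ → X → ℝ) (w : X → ℝ) : Prop :=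
  ∃ c : ℕ → ℝ, HasExpansion (fun z => ∫ x, g (z * f x) x * w x ∂μ) c ∧
    c 0 = ∫ x, w x * (∫ t, g t x) ∂σ ∧ Integrable (fun x => w x * ∫ t, g t x) σ

theorem HasExpansion.add {F F' : ℝ → ℝ} {c c' : ℕ → ℝ} (h : HasExpansion F c)
    (h' : HasExpansion F' c') : HasExpansion (fun z => F z + F' z) (fun j => c j + c' j) := by
  intro N
  refine ((h N).add (h' N)).congr_left fun z => ?_
  simp only [add_mul, Finset.sum_add_distrib]
  ring

theorem HasFiberExpansion.add {μ σ : Measure X} {f : X → ℝ} {g : ℝ → X → ℝ} {w w' : X → ℝ}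
    (h : HasFiberExpansion μ σ f g w) (h' : HasFiberExpansion μ σ f g w')
    (hi : ∀ z : ℝ, Integrable (fun x => g (z * f x) x * w x) μ)
    (hi' : ∀ z : ℝ, Integrable (fun x => g (z * f x) x * w' x) μ) :
    HasFiberExpansion μ σ f g (fun x => w x + w' x) := by
  obtain ⟨c, hc, hc0, hci⟩ := h
  obtain ⟨c', hc', hc0', hci'⟩ := h'
  refine ⟨fun j => c j + c' j, ?_, ?_, ?_⟩
  · convert hc.add hc' using 2 with z
    rw [← integral_add (hi z) (hi' z)]
    simp only [mul_add]
  · simp only [add_mul]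
    rw [hc0, hc0', ← integral_add hci hci']
  · simp only [add_mul]
    exact hci.add hci'

/-- The leading term of an expansion. -/
theorem HasExpansion.sub_leading {F : ℝ → ℝ} {c : ℕ → ℝ} (h : HasExpansion F c) :
    (fun z : ℝ => F z - z⁻¹ * c 0) =O[atTop] (fun z : ℝ => z⁻¹ ^ 2) := by
  simpa [mul_comm] using h 1

end Expansion

/-! ### Absolute convergence and the region away from the fiber -/

section Decay

variable {X : Type*} [TopologicalSpace X] [MeasurableSpace X] [BorelSpace X]
  {μ : Measure X} {f : X → ℝ} {g : ℝ → X → ℝ} {M : ℕ → X → ℝ} {w : X → ℝ} {b : ℝ}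

omit [MeasurableSpace X] [BorelSpace X] in
theorem continuous_integrand (hf : Continuous f) (hg : Continuous fun p : ℝ × X => g p.1 p.2)
    (hw : Continuous w) (z : ℝ) : Continuous fun x => g (z * f x) x * w x :=
  (hg.comp ((continuous_const.mul hf).prodMk continuous_id)).mul hw

/-- M 0 bounds |g(t, x)| for all t, so it dominates the integrand for all z at once, whatever f is.
-/
theorem integrable_integrand (hf : Continuous f) (hg : Continuous fun p : ℝ × X => g p.1 p.2)
    (hM : ∀ k, Integrable (M k) μ) (hgM : ∀ᵐ x ∂μ, ∀ k t, |t| ^ k * |g t x| ≤ M k x)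
    (hw : Continuous w) (hwb : ∀ x, |w x| ≤ b) (z : ℝ) :
    Integrable (fun x => g (z * f x) x * w x) μ := by
  refine ((hM 0).mul_const b).mono'
    (continuous_integrand hf hg hw z).measurable.aestronglyMeasurable ?_
  filter_upwards [hgM] with x hx
  have h1 := hx 0 (z * f x)
  rw [pow_zero, one_mul] at h1
  rw [norm_mul, Real.norm_eq_abs, Real.norm_eq_abs]
  exact mul_le_mul h1 (hwb x) (abs_nonneg _) ((abs_nonneg _).trans h1)

/-- The contribution of the points away from the fiber is negligible. -/
theorem setIntegral_away_le (hf : Continuous f) (hg : Continuous fun p : ℝ × X => g p.1 p.2)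
    (hM : ∀ k, Integrable (M k) μ) (hM0 : ∀ k x, 0 ≤ M k x)
    (hgM : ∀ᵐ x ∂μ, ∀ k t, |t| ^ k * |g t x| ≤ M k x)
    (hw : Continuous w) (hwb : ∀ x, |w x| ≤ b) (hb : 0 ≤ b) {δ : ℝ} (hδ : 0 < δ) (N : ℕ) {z : ℝ}
    (hz : 1 ≤ z) :
    ∫ x in {x | δ < |f x|}, |g (z * f x) x * w x| ∂μ ≤
      (b * δ⁻¹ ^ N * ∫ x, M N x ∂μ) * z⁻¹ ^ N := by
  have hms : MeasurableSet {x | δ < |f x|} := (isOpen_lt continuous_const hf.abs).measurableSet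
  have hz0 : 0 < z := by linarith
  have hi := integrable_integrand hf hg hM hgM hw hwb z
  calc ∫ x in {x | δ < |f x|}, |g (z * f x) x * w x| ∂μ
      ≤ ∫ x in {x | δ < |f x|}, b * δ⁻¹ ^ N * z⁻¹ ^ N * M N x ∂μ := by
        refine setIntegral_mono_on_ae hi.abs.integrableOn ((hM N).const_mul _).integrableOn hms ?_
        filter_upwards [hgM] with x hx hxδ
        have h1 := hx N (z * f x)
        have h2 : (z * δ) ^ N ≤ |z * f x| ^ N := by
          rw [abs_mul, abs_of_pos hz0]
          have : δ ≤ |f x| := le_of_lt hxδ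
          gcongr
        have h3 : |g (z * f x) x| ≤ δ⁻¹ ^ N * z⁻¹ ^ N * M N x := by
          rw [← mul_pow, ← mul_inv, inv_pow, mul_comm δ z, inv_mul_eq_div,
            le_div_iff₀ (by positivity), mul_comm]
          exact (mul_le_mul_of_nonneg_right h2 (abs_nonneg _)).trans h1
        rw [abs_mul]
        calc |g (z * f x) x| * |w x| ≤ (δ⁻¹ ^ N * z⁻¹ ^ N * M N x) * b :=
              mul_le_mul h3 (hwb x) (abs_nonneg _) ((abs_nonneg _).trans h3)
          _ = _ := by ring
    _ ≤ ∫ x, b * δ⁻¹ ^ N * z⁻¹ ^ N * M N x ∂μ :=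
        setIntegral_le_integral ((hM N).const_mul _) (Eventually.of_forall fun x =>
          mul_nonneg (by positivity) (hM0 N x))
    _ = _ := by
        rw [integral_const_mul]
        ring

/-- The integrals whose weight vanishes near the fiber are negligible. -/
theorem hasFiberExpansion_of_away {σ : Measure X} (hσ : σ {x | f x ≠ 0} = 0)
    (hf : Continuous f) (hg : Continuous fun p : ℝ × X => g p.1 p.2)
    (hM : ∀ k, Integrable (M k) μ) (hM0 : ∀ k x, 0 ≤ M k x)
    (hgM : ∀ᵐ x ∂μ, ∀ k t, |t| ^ k * |g t x| ≤ M k x)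
    (hw : Continuous w) (hwb : ∀ x, |w x| ≤ b) (hb : 0 ≤ b) {δ : ℝ} (hδ : 0 < δ)
    (hwδ : ∀ x, w x ≠ 0 → δ < |f x|) : HasFiberExpansion μ σ f g w := by
  have hzero : (fun x => w x * ∫ t, g t x) =ᵐ[σ] fun _ => 0 := by
    have h1 : ∀ᵐ x ∂σ, f x = 0 := by
      rw [ae_iff]
      exact hσ
    filter_upwards [h1] with x hx
    have : w x = 0 := by
      by_contra h
      have := hwδ x h
      rw [hx, abs_zero] at this
      linarith
    rw [this, zero_mul]
  refine ⟨fun _ => 0, fun N => ?_, ?_, ?_⟩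
  · simp only [zero_mul, Finset.sum_const_zero, sub_zero]
    refine IsBigO.of_bound (b * δ⁻¹ ^ (N + 1) * ∫ x, M (N + 1) x ∂μ) ?_
    filter_upwards [eventually_ge_atTop (1 : ℝ)] with z hz
    have hz0 : 0 < z := by linarith
    have h1 : ∫ x in {x | δ < |f x|}, g (z * f x) x * w x ∂μ = ∫ x, g (z * f x) x * w x ∂μ := by
      refine setIntegral_eq_integral_of_forall_compl_eq_zero fun x hx => ?_
      have : w x = 0 := by
        by_contra h
        exact hx (hwδ x h)
      rw [this, mul_zero]
    rw [← h1, Real.norm_of_nonneg (by positivity : (0 : ℝ) ≤ z⁻¹ ^ (N + 1))]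
    exact (norm_integral_le_integral_norm _).trans
      (setIntegral_away_le hf hg hM hM0 hgM hw hwb hb hδ (N + 1) hz)
  · rw [integral_congr_ae hzero, integral_zero]
  · exact (integrable_congr hzero).2 (integrable_zero _ _ _)

end Decay

/-! ### The expansion in one adapted chart -/

section Local

variable {m : ℕ} {X : Type*} [TopologicalSpace X] [ChartedSpace (Model m) X]
  [IsManifold 𝓘(ℝ, Model m) ∞ X] {φ : OpenPartialHomeomorph X (Model m)} {ρ : Model m → ℝ}
  {f h : X → ℝ} {g : ℝ → X → ℝ}

omit [IsManifold 𝓘(ℝ, Model m) ∞ X] in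
theorem RapidlyDecreasingNear.rapidAt {p : X} (hp : RapidlyDecreasingNear m g p) :
    RapidAt (fun t y => g t ((chartAt (Model m) p).symm y)) (chartAt (Model m) p p) := by
  intro l N
  obtain ⟨C, hC⟩ := hp l N
  set c := chartAt (Model m) p
  have hcp : p ∈ c.source := mem_chart_source _ p
  refine ⟨C, ?_⟩
  have h1 : Tendsto c.symm (𝓝 (c p)) (𝓝 p) := c.tendsto_symm hcp
  filter_upwards [h1.eventually hC, c.open_target.mem_nhds (c.map_source hcp)] with y hy hyt t
  have := hy t
  rwa [c.right_inv hyt] at this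

omit [IsManifold 𝓘(ℝ, Model m) ∞ X] in
theorem contDiffOn_comp_symm {u : X → ℝ} (hφ : φ ∈ IsManifold.maximalAtlas 𝓘(ℝ, Model m) ∞ X)
    (hu : ContMDiff 𝓘(ℝ, Model m) 𝓘(ℝ, ℝ) ∞ u) :
    ContDiffOn ℝ ∞ (fun y => u (φ.symm y)) φ.target := by
  rw [← contMDiffOn_iff_contDiffOn]
  exact hu.comp_contMDiffOn (contMDiffOn_symm_of_mem_maximalAtlas hφ)

omit [IsManifold 𝓘(ℝ, Model m) ∞ X] in
theorem contDiffOn_comp_symm_param (hφ : φ ∈ IsManifold.maximalAtlas 𝓘(ℝ, Model m) ∞ X)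
    (hg : ContMDiff (𝓘(ℝ, ℝ).prod 𝓘(ℝ, Model m)) 𝓘(ℝ, ℝ) ∞ (fun p : ℝ × X => g p.1 p.2)) :
    ContDiffOn ℝ ∞ (fun p : ℝ × Model m => g p.1 (φ.symm p.2)) (Set.univ ×ˢ φ.target) := by
  rw [← contMDiffOn_iff_contDiffOn]
  have h1 : ContMDiffOn 𝓘(ℝ, ℝ × Model m) 𝓘(ℝ, ℝ) ∞ (fun p : ℝ × Model m => p.1)
      (Set.univ ×ˢ φ.target) := contDiff_fst.contMDiff.contMDiffOn
  have h2 : ContMDiffOn 𝓘(ℝ, ℝ × Model m) 𝓘(ℝ, Model m) ∞ (fun p : ℝ × Model m => φ.symm p.2)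
      (Set.univ ×ˢ φ.target) :=
    (contMDiffOn_symm_of_mem_maximalAtlas hφ).comp
      (t := φ.target) contDiff_snd.contMDiff.contMDiffOn fun p hp => hp.2
  exact hg.comp_contMDiffOn (h1.prodMk h2)

/-- In adapted coordinates, the integrand is rapidly decreasing at the points of the fiber. -/
theorem rapidAt_coordExt (hφ : IsAdaptedChart f φ) (hρ : ContDiffOn ℝ ∞ ρ φ.target)
    (hh : ContMDiff 𝓘(ℝ, Model m) 𝓘(ℝ, ℝ) ∞ h) (hc : HasCompactSupport h)
    (hs : tsupport h ⊆ φ.source)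
    (hg : ContMDiff (𝓘(ℝ, ℝ).prod 𝓘(ℝ, Model m)) 𝓘(ℝ, ℝ) ∞ (fun p : ℝ × X => g p.1 p.2))
    (hgS : ∀ p, f p = 0 → RapidlyDecreasingNear m g p) (y : Model m) (hy : y 0 = 0) :
    RapidAt (fun t => coordExt φ ρ fun x => g t x * h x) y := by
  by_cases hyt : y ∈ φ.target
  · set x := φ.symm y with hx
    have hfx : f x = 0 := by rw [← hφ.2 _ (φ.map_target hyt), φ.right_inv hyt, hy]
    set c := chartAt (Model m) x with hcdef
    have hcm : c ∈ IsManifold.maximalAtlas 𝓘(ℝ, Model m) ∞ X :=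
      IsManifold.chart_mem_maximalAtlas x
    have h1 := (hgS x hfx).rapidAt
    set W := (φ.symm.trans c).source with hWdef
    have hWo : IsOpen W := (φ.symm.trans c).open_source
    have hyW : y ∈ W := by
      rw [hWdef, OpenPartialHomeomorph.trans_source]
      exact ⟨hyt, mem_chart_source _ x⟩
    have hWt : W ⊆ φ.target := fun y' hy' => hy'.1
    have hT : ContDiffOn ℝ ∞ (c ∘ φ.symm) W := by
      rw [← contMDiffOn_iff_contDiffOn]
      exact (contMDiffOn_of_mem_maximalAtlas hcm).comp
        ((contMDiffOn_symm_of_mem_maximalAtlas hφ.1).mono hWt) fun y' hy' => hy'.2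
    have hgt : ∀ {e : OpenPartialHomeomorph X (Model m)},
        e ∈ IsManifold.maximalAtlas 𝓘(ℝ, Model m) ∞ X → ∀ t,
          ContDiffOn ℝ ∞ (fun y => g t (e.symm y)) e.target := fun he t =>
      (contDiffOn_comp_symm_param he hg).comp (contDiff_const.prodMk contDiff_id).contDiffOn
        fun y' hy' => ⟨Set.mem_univ t, hy'⟩
    -- The assumption is stated in the preferred chart at x; the transition map carries it to the
    -- adapted chart φ.
    have h2 := RapidAt.comp (G := fun t y => g t (c.symm y)) (T := c ∘ φ.symm) (y := y)
      c.open_target hWo (hgt hcm) hT (fun y' hy' => c.map_source hy'.2) hyW h1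
    have h3 : RapidAt (fun t y' => g t (φ.symm y')) y := by
      refine h2.congr ?_
      filter_upwards [hWo.mem_nhds hyW] with y' hy' t
      simp only [Function.comp_apply]
      rw [c.left_inv (show φ.symm y' ∈ c.source from hy'.2)]
    have h4 := h3.mul φ.open_target (hgt hφ.1) (hρ.mul (contDiffOn_comp_symm hφ.1 hh)) hyt
    refine h4.congr ?_
    filter_upwards [φ.open_target.mem_nhds hyt] with y' hy' t
    rw [coordExt, Set.indicator_of_mem hy']
    ring
  -- Outside the target the extension vanishes near y, because the image of the support of h is
  -- compact, hence closed.
  · refine (RapidAt.zero y).congr ?_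
    have hyK : y ∉ φ '' tsupport h := fun h' => hyt (image_tsupport_subset hs h')
    filter_upwards [(isCompact_image_tsupport hc hs).isClosed.isOpen_compl.mem_nhds hyK]
      with y' hy' t
    by_cases hyt' : y' ∈ φ.target
    · rw [coordExt, Set.indicator_of_mem hyt', apply_symm_eq_zero hyt' hy', mul_zero, mul_zero]
    · rw [coordExt, Set.indicator_of_notMem hyt']

omit [IsManifold 𝓘(ℝ, Model m) ∞ X] in
theorem contDiff_coordExt_param (hφ : IsAdaptedChart f φ) (hρ : ContDiffOn ℝ ∞ ρ φ.target)
    (hh : ContMDiff 𝓘(ℝ, Model m) 𝓘(ℝ, ℝ) ∞ h) (hc : HasCompactSupport h)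
    (hs : tsupport h ⊆ φ.source)
    (hg : ContMDiff (𝓘(ℝ, ℝ).prod 𝓘(ℝ, Model m)) 𝓘(ℝ, ℝ) ∞ (fun p : ℝ × X => g p.1 p.2)) :
    ContDiff ℝ ∞ (fun p : ℝ × Model m => coordExt φ ρ (fun x => g p.1 x * h x) p.2) := by
  have h1 : (fun p : ℝ × Model m => coordExt φ ρ (fun x => g p.1 x * h x) p.2) =
      (Set.univ ×ˢ φ.target).indicator fun p : ℝ × Model m =>
        ρ p.2 * (g p.1 (φ.symm p.2) * h (φ.symm p.2)) := by
    funext p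
    by_cases hp : p.2 ∈ φ.target
    · rw [coordExt, Set.indicator_of_mem hp, Set.indicator_of_mem (by simpa using hp)]
    · rw [coordExt, Set.indicator_of_notMem hp, Set.indicator_of_notMem (by simpa using hp)]
  rw [h1]
  have hsnd : ContDiffOn ℝ ∞ (fun p : ℝ × Model m => p.2) (Set.univ ×ˢ φ.target) :=
    contDiff_snd.contDiffOn
  refine contDiff_indicator (K := Set.univ ×ˢ (φ '' tsupport h)) (isOpen_univ.prod φ.open_target)
    (isClosed_univ.prod (isCompact_image_tsupport hc hs).isClosed)
    (Set.prod_mono le_rfl (image_tsupport_subset hs)) ?_ ?_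
  · exact (hρ.comp hsnd fun p hp => hp.2).mul ((contDiffOn_comp_symm_param hφ.1 hg).mul
      ((contDiffOn_comp_symm hφ.1 hh).comp hsnd fun p hp => hp.2))
  · intro p hp hp'
    have : p.2 ∉ φ '' tsupport h := fun h' => hp' ⟨Set.mem_univ _, h'⟩
    rw [apply_symm_eq_zero hp.2 this, mul_zero, mul_zero]

variable [MeasurableSpace X] [BorelSpace X]

/-- The expansion for a weight supported in the domain of adapted coordinates. -/
theorem hasFiberExpansion_of_chart {μ σ : Measure X}
    (hf : ContMDiff 𝓘(ℝ, Model m) 𝓘(ℝ, ℝ) ∞ f) (hσ : IsLerayMeasure m f μ σ)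
    (hφ : IsAdaptedChart f φ) (hρ : IsChartDensity μ φ ρ)
    (hh : ContMDiff 𝓘(ℝ, Model m) 𝓘(ℝ, ℝ) ∞ h) (hc : HasCompactSupport h)
    (hs : tsupport h ⊆ φ.source)
    (hg : ContMDiff (𝓘(ℝ, ℝ).prod 𝓘(ℝ, Model m)) 𝓘(ℝ, ℝ) ∞ (fun p : ℝ × X => g p.1 p.2))
    (hgS : ∀ p, f p = 0 → RapidlyDecreasingNear m g p)
    (hoff : ∀ δ > 0, ∀ N : ℕ, ∃ C : ℝ, ∀ z ≥ 1,
      ∫ x in {x | δ < |f x|}, |g (z * f x) x * h x| ∂μ ≤ C * z⁻¹ ^ N) :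
    HasFiberExpansion μ σ f g h := by
  set H : ℝ → Model m → ℝ := fun t => coordExt φ ρ fun x => g t x * h x with hH
  have hh0 : ∀ x, x ∉ φ.source → h x = 0 := fun x hx =>
    image_eq_zero_of_notMem_tsupport fun h' => hx (hs h')
  have hfφ : ∀ y ∈ φ.target, f (φ.symm y) = y 0 := fun y hy => by
    rw [← hφ.2 _ (φ.map_target hy), φ.right_inv hy]
  have hcont := fun z => continuous_integrand hf.continuous hg.continuous hh.continuous z
  obtain ⟨c, hexp, hc0, hci⟩ := exists_hasExpansion_model H
    (contDiff_coordExt_param hφ hρ.1 hh hc hs hg) (isCompact_image_tsupport hc hs)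
    (fun y hy t => by
      by_cases hyt : y ∈ φ.target
      · simp only [hH, coordExt]
        rw [Set.indicator_of_mem hyt, apply_symm_eq_zero hyt hy, mul_zero, mul_zero]
      · simp only [hH, coordExt]
        rw [Set.indicator_of_notMem hyt])
    (rapidAt_coordExt hφ hρ.1 hh hc hs hg hgS)
    (fun δ hδ N => by
      obtain ⟨C, hC⟩ := hoff δ hδ N
      refine ⟨C, fun z hz => le_of_eq_of_le ?_ (hC z hz)⟩
      have hms : MeasurableSet {x | δ < |f x|} :=
        (isOpen_lt continuous_const hf.continuous.abs).measurableSet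
      have hms' : MeasurableSet {y : Model m | δ < |y 0|} := by
        have : Continuous fun y : Model m => |y 0| := by fun_prop
        exact (isOpen_lt continuous_const this).measurableSet
      have h1 := setIntegral_source_eq hρ
        ((hcont z).abs.stronglyMeasurable.indicator hms)
      rw [setIntegral_eq_integral_of_forall_compl_eq_zero, integral_indicator hms] at h1
      · rw [h1, ← integral_indicator hms']
        refine integral_congr_ae (Eventually.of_forall fun y => ?_)
        simp only
        by_cases hy : y ∈ φ.target
        · rw [Set.indicator_of_mem hy]
          by_cases hyδ : δ < |y 0|
          · rw [Set.indicator_of_mem (show y ∈ {y : Model m | δ < |y 0|} from hyδ),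
              Set.indicator_of_mem (show φ.symm y ∈ {x | δ < |f x|} by
                simpa [hfφ y hy] using hyδ)]
            simp only [hH, coordExt]
            rw [Set.indicator_of_mem hy, hfφ y hy, abs_mul, abs_of_nonneg (hρ.2.1 y hy)]
          · rw [Set.indicator_of_notMem (show y ∉ {y : Model m | δ < |y 0|} from hyδ),
              Set.indicator_of_notMem (show φ.symm y ∉ {x | δ < |f x|} by
                simpa [hfφ y hy] using hyδ), mul_zero]
        · rw [Set.indicator_of_notMem hy]
          refine Set.indicator_apply_eq_zero.2 fun _ => ?_
          simp only [hH, coordExt]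
          rw [Set.indicator_of_notMem hy, abs_zero]
      · intro x hx
        refine Set.indicator_apply_eq_zero.2 fun _ => ?_
        rw [hh0 x hx, mul_zero, abs_zero])
  have hσφ := (isLerayMeasure_iff.1 hσ).2 φ hφ ρ hρ
  have hGm : StronglyMeasurable fun x => h x * ∫ t, g t x := by
    refine hh.continuous.stronglyMeasurable.mul ?_
    have h1 : StronglyMeasurable (Function.uncurry fun (x : X) (t : ℝ) => g t x) :=
      (hg.continuous.comp continuous_swap).stronglyMeasurable
    exact h1.integral_prod_right
  have hGH : ∀ y : Model m, ∫ t, H t y =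
      φ.target.indicator (fun y => ρ y * (h (φ.symm y) * ∫ t, g t (φ.symm y))) y := by
    intro y
    simp only [hH, coordExt]
    by_cases hy : y ∈ φ.target
    · simp only [Set.indicator_of_mem hy]
      rw [integral_const_mul, integral_mul_const, mul_comm (h _)]
    · simp only [Set.indicator_of_notMem hy, integral_zero]
  refine ⟨c, ?_, ?_, ?_⟩
  · convert hexp using 2 with z
    rw [← setIntegral_eq_integral_of_forall_compl_eq_zero (s := φ.source)
      (fun x hx => by rw [hh0 x hx, mul_zero]), setIntegral_source_eq hρ
      (hcont z).stronglyMeasurable]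
    refine integral_congr_ae (Eventually.of_forall fun y => ?_)
    simp only [hH, coordExt]
    by_cases hy : y ∈ φ.target
    · simp only [Set.indicator_of_mem hy, hfφ y hy]
    · simp only [Set.indicator_of_notMem hy]
  · rw [hc0, ← setIntegral_eq_integral_of_forall_compl_eq_zero (s := φ.source) (μ := σ)
      (fun x hx => by rw [hh0 x hx, zero_mul]), hσφ, integral_map_sliceMeasure hρ hGm]
    simp only [hGH]
  · rw [← integrableOn_iff_integrable_of_support_subset (s := φ.source), IntegrableOn, hσφ]
    · refine integrable_map_sliceMeasure hρ hGm ?_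
      simpa only [hGH] using hci
    · intro x hx
      by_contra hx'
      exact hx (by simp only [hh0 x hx', zero_mul])

end Local

/-! ### From charts to the whole fiber -/

section Main

variable {m : ℕ} {X : Type*} [TopologicalSpace X] [ChartedSpace (Model m) X]
  [IsManifold 𝓘(ℝ, Model m) ∞ X] [MeasurableSpace X] [BorelSpace X]

omit [BorelSpace X] in
-- With second countability this makes μ σ-finite, as Fubini on ℝ × X requires.
theorem IsSmoothDensity.isLocallyFiniteMeasure {μ : Measure X} (hμ : IsSmoothDensity m μ) :
    IsLocallyFiniteMeasure μ := by
  refine ⟨fun x => ?_⟩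
  set c := chartAt (Model m) x
  have hxc : x ∈ c.source := mem_chart_source _ x
  obtain ⟨ρ, hρ⟩ := hμ c (IsManifold.chart_mem_maximalAtlas x)
  obtain ⟨K, hK, hxK, hKt⟩ := exists_compact_subset c.open_target (c.map_source hxc)
  refine ⟨c.source ∩ c ⁻¹' K, Filter.inter_mem (c.open_source.mem_nhds hxc)
    ((c.continuousAt hxc).preimage_mem_nhds (mem_interior_iff_mem_nhds.1 hxK)), ?_⟩
  rw [hρ.2.2 K hK.measurableSet, Set.inter_eq_right.2 hKt]
  have h1 : IntegrableOn ρ K := (hρ.1.continuousOn.mono hKt).integrableOn_compact hK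
  exact lt_of_le_of_lt (lintegral_mono fun y => Real.ofReal_le_enorm (ρ y)) h1.2

omit [IsManifold 𝓘(ℝ, Model m) ∞ X] [MeasurableSpace X] [BorelSpace X] in
-- The Fourier hypothesis gives integrability in t only μ-almost everywhere, which says nothing on a
-- μ-null fiber. At a point of the fiber, order 0 and weight 2 of the decay suffice.
theorem RapidlyDecreasingNear.integrable {g : ℝ → X → ℝ} {p : X}
    (hp : RapidlyDecreasingNear m g p) (hg : Continuous fun t => g t p) :
    Integrable fun t => g t p := by
  obtain ⟨C, hC⟩ := hp 0 2
  have h1 := hC.self_of_nhds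
  refine (integrable_inv_one_add_sq.const_mul C).mono' hg.aestronglyMeasurable
    (Eventually.of_forall fun t => ?_)
  have h2 := h1 t
  rw [norm_iteratedFDeriv_zero, (chartAt (Model m) p).left_inv (mem_chart_source _ p)] at h2
  have h3 := pow_mul_le_of_one_add_pow_mul_le (N := 0) (norm_nonneg _) h2
  simpa using h3

omit [IsManifold 𝓘(ℝ, Model m) ∞ X] [MeasurableSpace X] [BorelSpace X]
  [ChartedSpace (Model m) X] in
/-- A function that is bounded below outside a compact set is bounded below on each closed set
that misses its zeros. -/
theorem exists_pos_forall_lt_abs {f : X → ℝ} (hf : Continuous f)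
    (hfpos : ∃ K : Set X, IsCompact K ∧ ∃ C : ℝ, 0 < C ∧ ∀ x, x ∉ K → C ≤ |f x|) {A : Set X}
    (hA : IsClosed A) (hfA : ∀ x ∈ A, f x ≠ 0) : ∃ δ > 0, ∀ x ∈ A, δ < |f x| := by
  obtain ⟨K, hK, C, hC, hKC⟩ := hfpos
  obtain ⟨a, ha, hKa⟩ : ∃ a > 0, ∀ x ∈ K ∩ A, a ≤ |f x| := by
    rcases (K ∩ A).eq_empty_or_nonempty with h | h
    · exact ⟨1, one_pos, by simp [h]⟩
    · obtain ⟨x₀, hx₀, hmin⟩ := (hK.inter_right hA).exists_isMinOn h hf.abs.continuousOn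
      exact ⟨|f x₀|, abs_pos.2 (hfA x₀ hx₀.2), fun x hx => hmin hx⟩
  refine ⟨min a C / 2, by positivity, fun x hx => ?_⟩
  have h1 : 0 < min a C := lt_min ha hC
  by_cases hxK : x ∈ K
  · have := hKa x ⟨hxK, hx⟩
    have := min_le_left a C
    linarith
  · have := hKC x hxK
    have := min_le_right a C
    linarith

variable [T2Space X]

/-- The expansion of the integral with a bounded weight `w`, when `f` is regular at the points of
the fiber that belong to the support of `w`. -/
theorem hasFiberExpansion_of_regular {μ σ : Measure X} (hμ : IsSmoothDensity m μ) {f : X → ℝ}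
    (hf : ContMDiff 𝓘(ℝ, Model m) 𝓘(ℝ, ℝ) ∞ f)
    (hfpos : ∃ K : Set X, IsCompact K ∧ ∃ C : ℝ, 0 < C ∧ ∀ x, x ∉ K → C ≤ |f x|)
    {g : ℝ → X → ℝ}
    (hg : ContMDiff (𝓘(ℝ, ℝ).prod 𝓘(ℝ, Model m)) 𝓘(ℝ, ℝ) ∞ (fun p : ℝ × X => g p.1 p.2))
    {M : ℕ → X → ℝ} (hM : ∀ k, Integrable (M k) μ) (hM0 : ∀ k x, 0 ≤ M k x)
    (hgM : ∀ᵐ x ∂μ, ∀ k t, |t| ^ k * |g t x| ≤ M k x)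
    (hgS : ∀ p, f p = 0 → RapidlyDecreasingNear m g p)
    (hσ : IsLerayMeasure m f μ σ) {w : X → ℝ} (hw : ContMDiff 𝓘(ℝ, Model m) 𝓘(ℝ, ℝ) ∞ w)
    {b : ℝ} (hwb : ∀ x, |w x| ≤ b)
    (hreg : ∀ x, f x = 0 → x ∈ tsupport w → IsRegularPoint m f x) :
    HasFiberExpansion μ σ f g w := by
  classical
  have hchart : ∀ p : {p // IsRegularPoint m f p}, ∃ φ : OpenPartialHomeomorph X (Model m),
      IsAdaptedChart f φ ∧ ∃ ψ : SmoothBumpFunction 𝓘(ℝ, Model m) (p : X),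
        tsupport ψ ⊆ φ.source := by
    intro p
    obtain ⟨φ, hpφ, hφ⟩ := p.2.exists_isAdaptedChart hf
    obtain ⟨ψ, -, hψ⟩ := (SmoothBumpFunction.nhds_basis_tsupport (I := 𝓘(ℝ, Model m))
      (p : X)).mem_iff.1 (φ.open_source.mem_nhds hpφ)
    exact ⟨φ, hφ, ψ, hψ⟩
  choose φ hφ ψ hψ using hchart
  -- Near each point of V p the function 1 - ψ p vanishes, so multiplying by it removes V p from the
  -- support of a weight.
  set V : {p // IsRegularPoint m f p} → Set X := fun p => interior {x | ψ p x = 1} with hV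
  have hσ0 : σ {x | f x ≠ 0} = 0 := by
    have h0 : {x | f x ≠ 0} ⊆ {x | ¬ (f x = 0 ∧ IsRegularPoint m f x)} := fun x hx h => hx h.1
    exact measure_mono_null h0 hσ.1
  have hint := fun {w : X → ℝ} (hw : Continuous w) {b : ℝ} (hwb : ∀ x, |w x| ≤ b) =>
    integrable_integrand hf.continuous hg.continuous hM hgM hw hwb
  -- Induction on the cover replaces a partition of unity: w = ψ w + (1 - ψ) w, where the first term
  -- lives in one chart and the second needs one chart fewer. Both keep the bound b because 0 ≤ ψ ≤
  -- 1.
  have key : ∀ (T : Finset {p // IsRegularPoint m f p}) (w : X → ℝ),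
      ContMDiff 𝓘(ℝ, Model m) 𝓘(ℝ, ℝ) ∞ w → (∀ x, |w x| ≤ b) →
      (∀ x, f x = 0 → x ∈ tsupport w → ∃ p ∈ T, x ∈ V p) → HasFiberExpansion μ σ f g w := by
    intro T
    induction T using Finset.induction_on with
    | empty =>
      intro w hw hwb hwT
      -- With no chart left, f has no zero on the support of w, and the lower bound on |f| outside K
      -- makes |f| > δ there.
      obtain ⟨δ, hδ, hδw⟩ := exists_pos_forall_lt_abs hf.continuous hfpos (isClosed_tsupport w)
        fun x hx h0 => by simpa using hwT x h0 hx
      rcases isEmpty_or_nonempty X with hX | ⟨⟨x₀⟩⟩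
      · exact hasFiberExpansion_of_away hσ0 hf.continuous hg.continuous hM hM0 hgM hw.continuous
          (b := 0) (fun x => (hX.false x).elim) le_rfl hδ fun x => (hX.false x).elim
      · exact hasFiberExpansion_of_away hσ0 hf.continuous hg.continuous hM hM0 hgM hw.continuous
          hwb ((abs_nonneg _).trans (hwb x₀)) hδ fun x hx => hδw x (subset_tsupport w hx)
    | insert p T hp ih =>
      intro w hw hwb hwT
      have hψs : ContMDiff 𝓘(ℝ, Model m) 𝓘(ℝ, ℝ) ∞ (ψ p) := (ψ p).contMDiff
      have h1s : ContMDiff 𝓘(ℝ, Model m) 𝓘(ℝ, ℝ) ∞ fun x => ψ p x * w x := hψs.mul hw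
      have h2s : ContMDiff 𝓘(ℝ, Model m) 𝓘(ℝ, ℝ) ∞ fun x => (1 - ψ p x) * w x :=
        (contMDiff_const.sub hψs).mul hw
      have h1b : ∀ x, |ψ p x * w x| ≤ b := fun x => by
        rw [abs_mul, abs_of_nonneg (ψ p).nonneg]
        exact (mul_le_of_le_one_left (abs_nonneg _) (ψ p).le_one).trans (hwb x)
      have h2b : ∀ x, |(1 - ψ p x) * w x| ≤ b := fun x => by
        have h3 : 0 ≤ ψ p x := (ψ p).nonneg
        have h4 : ψ p x ≤ 1 := (ψ p).le_one
        rw [abs_mul, abs_of_nonneg (by linarith : 0 ≤ 1 - ψ p x)]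
        exact (mul_le_of_le_one_left (abs_nonneg _) (by linarith)).trans (hwb x)
      have h1 : HasFiberExpansion μ σ f g fun x => ψ p x * w x := by
        obtain ⟨ρ, hρ⟩ := hμ (φ p) (hφ p).1
        refine hasFiberExpansion_of_chart hf hσ (hφ p) hρ h1s (ψ p).hasCompactSupport.mul_right
          ((tsupport_mul_subset_left (f := ψ p) (g := w)).trans (hψ p)) hg hgS fun δ hδ N => ?_
        exact ⟨_, fun z hz => setIntegral_away_le hf.continuous hg.continuous hM hM0 hgM
          h1s.continuous h1b ((abs_nonneg _).trans (h1b p)) hδ N hz⟩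
      have h2 : HasFiberExpansion μ σ f g fun x => (1 - ψ p x) * w x := by
        refine ih _ h2s h2b fun x hx0 hxs => ?_
        obtain ⟨q, hq, hxq⟩ := hwT x hx0
          (tsupport_mul_subset_right (f := fun x => 1 - ψ p x) (g := w) hxs)
        rcases Finset.mem_insert.1 hq with rfl | hq
        · exfalso
          refine notMem_tsupport_iff_eventuallyEq.2 ?_ hxs
          filter_upwards [isOpen_interior.mem_nhds hxq] with y hy
          have h3 : y ∈ {x | ψ q x = 1} := interior_subset hy
          have : ψ q y = 1 := h3
          simp [this]
        · exact ⟨q, hq, hxq⟩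
      convert h1.add h2 (hint h1s.continuous h1b) (hint h2s.continuous h2b) using 2 with x
      ring
  have hcomp : IsCompact (f ⁻¹' {0} ∩ tsupport w) := by
    obtain ⟨K, hK, C, hC, hKC⟩ := hfpos
    refine hK.of_isClosed_subset ((isClosed_singleton.preimage hf.continuous).inter
      (isClosed_tsupport w)) fun x hx => ?_
    by_contra hxK
    have h1 := hKC x hxK
    have h2 : f x = 0 := hx.1
    rw [h2, abs_zero] at h1
    linarith
  obtain ⟨T, hT⟩ := hcomp.elim_finite_subcover V (fun _ => isOpen_interior) fun x hx =>
    Set.mem_iUnion.2 ⟨⟨x, hreg x hx.1 hx.2⟩,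
      mem_interior_iff_mem_nhds.2 (ψ ⟨x, hreg x hx.1 hx.2⟩).eventuallyEq_one⟩
  refine key T w hw hwb fun x hx hxs => ?_
  simpa using hT ⟨hx, hxs⟩

variable [SecondCountableTopology X]

/-- The conclusions for the weight `1 - Θ`. -/
theorem regularIntegral_asymptotics
    (μ : Measure X) (hμ : IsSmoothDensity m μ)
    (f : X → ℝ) (hf : ContMDiff 𝓘(ℝ, Model m) 𝓘(ℝ, ℝ) ∞ f)
    (hfpos : ∃ K : Set X, IsCompact K ∧ ∃ C : ℝ, 0 < C ∧ ∀ x, x ∉ K → C ≤ |f x|)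
    (g : ℝ → X → ℝ)
    (hg : ContMDiff (𝓘(ℝ, ℝ).prod 𝓘(ℝ, Model m)) 𝓘(ℝ, ℝ) ∞
      (fun p : ℝ × X => g p.1 p.2))
    (hgF : FourierL1 μ g)
    (hgS : ∀ p, f p = 0 → RapidlyDecreasingNear m g p)
    (σ : Measure X) (hσ : IsLerayMeasure m f μ σ)
    (Θ : X → ℝ) (hΘ : ContMDiff 𝓘(ℝ, Model m) 𝓘(ℝ, ℝ) ∞ Θ)
    (hΘc : HasCompactSupport Θ)
    (hreg : ∀ x, f x = 0 → x ∈ tsupport (fun x => 1 - Θ x) → IsRegularPoint m f x) :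
    (∀ z : ℝ, Integrable (fun x => g (z * f x) x * (1 - Θ x)) μ) ∧
      (∀ x, f x = 0 → Integrable (fun t : ℝ => g t x)) ∧
      Integrable (fun x => (1 - Θ x) * ∫ t : ℝ, g t x) σ ∧
      (∃ c : ℕ → ℝ, HasExpansion (regularIntegral μ f g Θ) c) ∧
      (fun z : ℝ => regularIntegral μ f g Θ z - z⁻¹ * ∫ x, (1 - Θ x) * (∫ t : ℝ, g t x) ∂σ)
        =O[atTop] (fun z : ℝ => z⁻¹ ^ 2) := by
  have := ChartedSpace.locallyCompactSpace (Model m) X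
  have := hμ.isLocallyFiniteMeasure
  have hgt : ∀ x, Continuous fun t => g t x := fun x =>
    hg.continuous.comp (continuous_id.prodMk continuous_const)
  obtain ⟨M, hM, hM0, hgM⟩ := hgF.exists_moment_bound hgt
  obtain ⟨b, hb⟩ := hΘc.exists_bound_of_continuous hΘ.continuous
  have hw : ContMDiff 𝓘(ℝ, Model m) 𝓘(ℝ, ℝ) ∞ fun x => 1 - Θ x := contMDiff_const.sub hΘ
  have hwb : ∀ x, |1 - Θ x| ≤ 1 + b := fun x => (abs_sub _ _).trans (by
    rw [abs_one]
    exact add_le_add le_rfl (hb x))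
  obtain ⟨c, hc, hc0, hci⟩ := hasFiberExpansion_of_regular hμ hf hfpos hg hM hM0 hgM hgS hσ hw hwb
    hreg
  refine ⟨integrable_integrand hf.continuous hg.continuous hM hgM hw.continuous hwb,
    fun x hx => (hgS x hx).integrable (hgt x), hci, ⟨c, hc⟩, ?_⟩
  rw [← hc0]
  exact hc.sub_leading

end Main

end FiberIntegral

end

theorem mainTheorem4 {m : ℕ} {X : Type*} [TopologicalSpace X] [T2Space X]
    [SecondCountableTopology X] [ChartedSpace (FiberIntegral.Model m) X]
    [IsManifold 𝓘(ℝ, FiberIntegral.Model m) ∞ X] [MeasurableSpace X] [BorelSpace X]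
    (μ : Measure X) (hμ : FiberIntegral.IsSmoothDensity m μ)
    (f : X → ℝ) (hf : ContMDiff 𝓘(ℝ, FiberIntegral.Model m) 𝓘(ℝ, ℝ) ∞ f)
    (hfpos : ∃ K : Set X, IsCompact K ∧ ∃ C : ℝ, 0 < C ∧ ∀ x, x ∉ K → C ≤ |f x|)
    (g : ℝ → X → ℝ)
    (hg : ContMDiff (𝓘(ℝ, ℝ).prod 𝓘(ℝ, FiberIntegral.Model m)) 𝓘(ℝ, ℝ) ∞
      (fun p : ℝ × X => g p.1 p.2))
    (hgF : FiberIntegral.FourierL1 μ g)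
    (hgS : ∀ p, f p = 0 → FiberIntegral.RapidlyDecreasingNear m g p) :
    (∃! σ : Measure X, FiberIntegral.IsLerayMeasure m f μ σ) ∧
    ∀ σ : Measure X, FiberIntegral.IsLerayMeasure m f μ σ →
      -- the integral `I(z)`, when the whole fiber is regular
      ((∀ x, f x = 0 → FiberIntegral.IsRegularPoint m f x) →
        (∀ z : ℝ, Integrable (fun x => g (z * f x) x) μ) ∧
        (∀ x, f x = 0 → Integrable (fun t : ℝ => g t x)) ∧
        Integrable (fun x => ∫ t : ℝ, g t x) σ ∧
        (∃ c : ℕ → ℝ, FiberIntegral.HasExpansion (FiberIntegral.fiberIntegral μ f g) c) ∧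
        (fun z : ℝ => FiberIntegral.fiberIntegral μ f g z - z⁻¹ * ∫ x, (∫ t : ℝ, g t x) ∂σ)
          =O[atTop] (fun z : ℝ => z⁻¹ ^ 2)) ∧
      -- the integral `I_r(z)`, when the fiber is regular on the support of `1 - Θ`
      (∀ Θ : X → ℝ, ContMDiff 𝓘(ℝ, FiberIntegral.Model m) 𝓘(ℝ, ℝ) ∞ Θ → HasCompactSupport Θ →
        (∀ x, f x = 0 → x ∈ tsupport (fun x => 1 - Θ x) →
          FiberIntegral.IsRegularPoint m f x) →
        (∀ z : ℝ, Integrable (fun x => g (z * f x) x * (1 - Θ x)) μ) ∧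
        (∀ x, f x = 0 → Integrable (fun t : ℝ => g t x)) ∧
        Integrable (fun x => (1 - Θ x) * ∫ t : ℝ, g t x) σ ∧
        (∃ c : ℕ → ℝ, FiberIntegral.HasExpansion (FiberIntegral.regularIntegral μ f g Θ) c) ∧
        (fun z : ℝ => FiberIntegral.regularIntegral μ f g Θ z -
            z⁻¹ * ∫ x, (1 - Θ x) * (∫ t : ℝ, g t x) ∂σ)
          =O[atTop] (fun z : ℝ => z⁻¹ ^ 2)) := by
  refine ⟨FiberIntegral.existsUnique_isLerayMeasure hμ hf, fun σ hσ => ⟨fun hreg => ?_, ?_⟩⟩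
  -- The first integral is the second with Θ = 0.
  · have h := FiberIntegral.regularIntegral_asymptotics μ hμ f hf hfpos g hg hgF hgS σ hσ
      (fun _ => 0) contMDiff_const HasCompactSupport.zero fun x hx _ => hreg x hx
    unfold FiberIntegral.regularIntegral at h
    simp only [sub_zero, mul_one, one_mul] at h
    exact h
  · exact FiberIntegral.regularIntegral_asymptotics μ hμ f hf hfpos g hg hgF hgS σ hσ
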